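/- Fix $\alpha>0$ and $T>0$. For $n\ge 1$ let $\xi^n_{0,1}=\alpha/n$ and $\xi^n_{x,x+1}=1$ for $x\in\mathbb Z\setminus\{0\}$. Let $\mathcal L_n$ be the generator of the symmetric simple exclusion process on $\Omega=\{0,1\}^{\mathbb Z}$ with a slow bond at $\{0,1\}$, acting on local functions by $$(\mathcal L_nf)(\eta)=\sum_{x\in\mathbb Z}\xi^n_{x,x+1}\big(f(\eta^{x,x+1})-f(\eta)\big),$$ where $\eta^{x,x+1}$ is obtained from $\eta$ by exchanging $\eta(x)$ and $\eta(x+1)$. Let $(\mu_n)_{n}$ be probability measures on $\Omega$, let $(\eta_t)_{t\ge0}$ be the Markov process with generator $n^2\mathcal L_n$ and initial law $\mu_n$, with expectation $\mathbb E_{\mu_n}$, and put $$\rho^n_t(x)=\mathbb E_{\mu_n}[\eta_t(x)],\qquad \varphi^n_t(x,y)=\mathbb E_{\mu_n}[\eta_t(x)\eta_t(y)]-\rho^n_t(x)\rho^n_t(y).$$ Let $V=\{(x,y)\in\mathbb Z^2: y\ge x+1\}$. Let $\rho_0:\mathbb R\to[0,1]$ be Lipschitz on $(-\infty,0]$ and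 on $(0,\infty)$ (a jump at $0$ is allowed), and suppose that there are constants $c_1,c_2$ such that for all $n\ge1$ $$\sup_{x\in\mathbb Z}\big|\rho^n_0(x)-\rho_0(\tfrac xn)\big|\le\frac{c_1}{n},\qquad \sup_{(x,y)\in V}|\varphi^n_0(x,y)|\le\frac{c_2}{n}.$$ Let $U=\{(x,y)\in V: x\in\{0,1\},\,y\ge2\}\cup\{(x,y)\in V: x\le-1,\,y\in\{0,1\}\}$. Let $(\mathbf X_t,\mathbf Y_t)_{t\ge0}$ be the continuous-time random walk on $V$ which jumps from $u$ to $v$ with $\|u-v\|_1=1$ at rate $\alpha/n$ if $u,v\in U$ and either $|u_1-v_1|=1$ and $u_2,v_2\ge2$, or $|u_2-v_2|=1$ and $u_1,v_1\le-1$, and at rate $1$ for all other such pairs $u,v\in V$. Write $\mathbf E_{(x,y)}$ for its expectation when started from $(x,y)\in V$, $L_t(A)=\int_0^t\mathbf 1_{\{(\mathbf X_s,\mathbf Y_s)\in A\}}\,ds$ for its local time in $A\subseteq V$, and $D=\{(x,y)\in\mathbb Z^2:y=x+1\}$. Then there exists $C>0$, not depending on $n$ or $(x,y)$, such that for all $n\ge1$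 and all $(x,y)\in V$, $$\sup_{0\le t\le T}|\varphi^n_t(x,y)|\le\frac Cn+C\Big(\frac1{n^2}\,\mathbf E_{(x,y)}\big[L_{n^2T}(D\setminus\{(0,1)\})\big]+\frac1n\,\mathbf E_{(x,y)}\big[L_{n^2T}(\{(0,1)\})\big]\Big).$$ -/

import Mathlib

open MeasureTheory ProbabilityTheory Filter Topology
open scoped NNReal

noncomputable section

/-! ### Càdlàg paths and martingale problems -/

/-- The space `D([0,∞), E)` of right-continuous paths with left limits. -/
structure CadlagPath (E : Type*) [TopologicalSpace E] where
  toFun : ℝ≥0 → E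
  cadlag : ∀ t, ContinuousWithinAt toFun (Set.Ici t) t ∧ ∃ l, Tendsto toFun (𝓝[<] t) (𝓝 l)

instance (E : Type*) [TopologicalSpace E] : CoeFun (CadlagPath E) (fun _ => ℝ≥0 → E) :=
  ⟨CadlagPath.toFun⟩

/-- The σ-algebra on path space generated by the evaluation maps. -/
instance (E : Type*) [TopologicalSpace E] [MeasurableSpace E] : MeasurableSpace (CadlagPath E) :=
  ⨆ s : ℝ≥0, MeasurableSpace.comap (fun ω : CadlagPath E => ω s) inferInstance

theorem CadlagPath.measurable_eval {E : Type*} [TopologicalSpace E] [MeasurableSpace E]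
    (t : ℝ≥0) : Measurable (fun ω : CadlagPath E => ω t) := by
  rw [measurable_iff_comap_le]
  exact le_iSup
    (fun s : ℝ≥0 => MeasurableSpace.comap (fun ω : CadlagPath E => ω s) inferInstance) t

/-- The canonical filtration `ℱ_t = σ(ω_s : s ≤ t)` of path space. -/
def CadlagPath.filtration (E : Type*) [TopologicalSpace E] [MeasurableSpace E] :
    Filtration ℝ≥0 (inferInstance : MeasurableSpace (CadlagPath E)) where
  seq t := ⨆ s : ℝ≥0, ⨆ _ : s ≤ t,
    MeasurableSpace.comap (fun ω : CadlagPath E => ω s) inferInstance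
  mono' := fun _ _ hst => iSup_mono fun _ => iSup_mono' fun h => ⟨h.trans hst, le_rfl⟩
  le' := fun _ => iSup_mono fun _ => iSup_le fun _ => le_rfl

/-- `P` is the law on path space of the Markov process with initial law `μ` and with generator
given on the core `core` by `G`, characterized by the martingale problem: for every `f` in the core,
`f(ω_t) - f(ω_0) - ∫₀ᵗ (G f)(ω_s) ds` is a `P`-martingale for the canonical filtration. -/
structure SolvesMartingaleProblem {E : Type*} [TopologicalSpace E] [MeasurableSpace E]
    (core : Set (E → ℝ)) (G : (E → ℝ) → E → ℝ) (μ : Measure E) (P : Measure (CadlagPath E)) :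
    Prop where
  isProbabilityMeasure : IsProbabilityMeasure P
  initial : P.map (fun ω => ω 0) = μ
  martingale : ∀ f ∈ core,
    Martingale
      (fun (t : ℝ≥0) (ω : CadlagPath E) =>
        f (ω t) - f (ω 0) - ∫ s in (0 : ℝ)..(t : ℝ), G f (ω s.toNNReal))
      (CadlagPath.filtration E) P

/-- The law at time `t` of the process with path law `P`. -/
def lawAt {E : Type*} [TopologicalSpace E] [MeasurableSpace E]
    (P : Measure (CadlagPath E)) (t : ℝ≥0) : Measure E :=
  P.map (fun ω => ω t)

/-- The local time `L_t(A) = ∫₀ᵗ 1_{ω_s ∈ A} ds` of the path `ω` in the set `A`. -/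
def localTime {E : Type*} [TopologicalSpace E] (A : Set E) (t : ℝ) (ω : CadlagPath E) : ℝ :=
  ∫ s in (0 : ℝ)..t, A.indicator (fun _ => (1 : ℝ)) (ω s.toNNReal)

/-! ### The symmetric simple exclusion process on `ℤ` with a slow bond at `{0,1}` -/

/-- The state space `{0,1}^ℤ`, with the product topology and the product σ-algebra. -/
abbrev Config : Type := ℤ → Bool

/-- The occupation number `η(x) ∈ {0,1}`, as a real number. -/
def occ (η : Config) (x : ℤ) : ℝ := if η x then 1 else 0

/-- The configuration `η^{x,x+1}`. -/
def exchange (η : Config) (x : ℤ) : Config := fun y => η (Equiv.swap x (x + 1) y)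

/-- The exchange rate of the bond `{x, x+1}`. -/
def bondRate (α : ℝ) (n : ℕ) (x : ℤ) : ℝ := if x = 0 then α / n else 1

/-- Functions of the configuration that depend on finitely many coordinates only. -/
def localFunctions : Set (Config → ℝ) := {f | ∃ A : Finset ℤ, DependsOn f (A : Set ℤ)}

/-- The generator of the exclusion process with a slow bond. For a local function all but
finitely many terms of the sum vanish. -/
def exclusionGen (α : ℝ) (n : ℕ) (f : Config → ℝ) (η : Config) : ℝ :=
  ∑' x : ℤ, bondRate α n x * (f (exchange η x) - f η)

/-- `P` is the law of the exclusion process with a slow bond, accelerated by `n²` and started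
from `μ`. -/
def IsSlowBondExclusion (α : ℝ) (n : ℕ) (μ : Measure Config) (P : Measure (CadlagPath Config)) :
    Prop :=
  SolvesMartingaleProblem localFunctions (fun f η => (n : ℝ) ^ 2 * exclusionGen α n f η) μ P

/-- The mean occupation `E_ν[η(x)]`. -/
def siteMean (ν : Measure Config) (x : ℤ) : ℝ := ∫ η, occ η x ∂ν

/-- The two-point correlation `E_ν[η(x)η(y)] - E_ν[η(x)] E_ν[η(y)]`. -/
def siteCorr (ν : Measure Config) (x y : ℤ) : ℝ :=
  (∫ η, occ η x * occ η y ∂ν) - siteMean ν x * siteMean ν y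

/-! ### The two-dimensional random walk with slow bonds -/

/-- The set `V = {(x,y) ∈ ℤ² : y ≥ x + 1}`. -/
abbrev UpperV : Type := {p : ℤ × ℤ // p.1 + 1 ≤ p.2}

/-- The set `U` of end points of slow bonds. -/
def slowSites : Set (ℤ × ℤ) :=
  {p | (p.1 = 0 ∨ p.1 = 1) ∧ 2 ≤ p.2} ∪ {p | p.1 ≤ -1 ∧ (p.2 = 0 ∨ p.2 = 1)}

/-- The set of (oriented) slow bonds: horizontal bonds between points of `U` at height at least
`2`, and vertical bonds between points of `U` with abscissa at most `-1`. -/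
def slowEdges : Set ((ℤ × ℤ) × (ℤ × ℤ)) :=
  {e | e.1 ∈ slowSites ∧ e.2 ∈ slowSites ∧
    |e.1.1 - e.2.1| + |e.1.2 - e.2.2| = 1 ∧
    ((|e.1.1 - e.2.1| = 1 ∧ 2 ≤ e.1.2 ∧ 2 ≤ e.2.2) ∨
      (|e.1.2 - e.2.2| = 1 ∧ e.1.1 ≤ -1 ∧ e.2.1 ≤ -1))}

open Classical in
/-- The jump rates: `α/n` along slow bonds, `1` along all other nearest-neighbour bonds of `V`. -/
def walkRate (α : ℝ) (n : ℕ) (u v : UpperV) : ℝ :=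
  if |u.1.1 - v.1.1| + |u.1.2 - v.1.2| = 1 then
    if (u.1, v.1) ∈ slowEdges then α / n else 1
  else 0

/-- The generator of the walk on `V`; at most four terms of the sum are nonzero. -/
def walkGen (α : ℝ) (n : ℕ) (f : UpperV → ℝ) (u : UpperV) : ℝ :=
  ∑' v : UpperV, walkRate α n u v * (f v - f u)

/-- `Q` is the law of the slow-bond random walk on `V` (not accelerated) started from `z`. -/
def IsSlowBondWalk (α : ℝ) (n : ℕ) (z : UpperV) (Q : Measure (CadlagPath UpperV)) : Prop :=
  SolvesMartingaleProblem {f | (Function.support f).Finite} (walkGen α n) (Measure.dirac z) Q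

/-- The upper diagonal `D = {(x,y) : y = x + 1}`. -/
def upperDiag : Set UpperV := {p | p.1.2 = p.1.1 + 1}

/-- The point `(0,1)` of `V`. -/
def cornerPt : UpperV := ⟨(0, 1), by norm_num⟩

end

/-! Write `J_x = ξ_{x,x+1} (ρ(x+1) - ρ(x))` for the current through a bond. The correlations solve
the backward equation of the two-dimensional walk with a sink on the diagonal: `∂ₜφ = n² (L φ - 1_D
ξ_{x,x+1} (ρ(x+1) - ρ(x))²)`. Here `L` is the generator of the walk, because two exclusion
particles, seen through the product `η(x)η(y)`, move like the walk reflected at the diagonal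
(`exclusionGen_occ_mul`, `walkGen_eq_pairGen`). The sink is the defect between independent particles
and exclusion (`pairGen_sub_mul`, `IsSlowBondExclusion.hasDerivAt_occCorr`).

Duhamel's formula then bounds `|φ_t|` by `sup |φ_0|` plus the expected integral of the sink along
the walk (`IsSlowBondWalk.abs_le_add_integral`). At `(0,1)` the sink is at most `α/n`, since
densities lie in `[0,1]`. At the other diagonal points it is `J_x²`, so a gradient bound of order
`1/n` away from the slow bond is needed.

That bound comes from a maximum principle: for `x ≠ 0` the currents solve a discrete heat equation
in which `J_0` acts as a boundary value, and `|J_0| ≤ α/n`. Initially they are `O(1/n)` by the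
Lipschitz assumption (`IsSlowBondExclusion.abs_current_le`).

Both processes enter only through their martingale problems. The walk is tested on finitely
supported functions alone, so Duhamel's formula is proved with a cutoff whose commutator with `L`
vanishes in the limit. -/

/-! ### Expectations along càdlàg paths and the forward equation. -/

section PathExpectations

variable {E : Type*} [TopologicalSpace E] [MeasurableSpace E]

theorem tendsto_floor_add_one_div_nhdsGE (t : ℝ≥0) :
    Tendsto (fun k : ℕ => ((⌊t * (k + 1)⌋₊ + 1 : ℕ) : ℝ≥0) / (k + 1)) atTop (𝓝[≥] t) := by
  have hpos : ∀ k : ℕ, (0 : ℝ≥0) < k + 1 := fun k => by positivity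
  have hle : ∀ k : ℕ, t ≤ ((⌊t * (k + 1)⌋₊ + 1 : ℕ) : ℝ≥0) / (k + 1) := fun k => by
    rw [le_div_iff₀ (hpos k)]
    push_cast
    exact (Nat.lt_floor_add_one _).le
  refine tendsto_nhdsWithin_iff.2 ⟨?_, Eventually.of_forall hle⟩
  have hlim : Tendsto (fun k : ℕ => t + 1 / ((k : ℝ≥0) + 1)) atTop (𝓝 (t + 0)) :=
    tendsto_const_nhds.add tendsto_one_div_add_atTop_nhds_zero_nat
  rw [add_zero] at hlim
  refine tendsto_of_tendsto_of_tendsto_of_le_of_le tendsto_const_nhds hlim hle fun k => ?_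
  show _ / _ ≤ t + 1 / _
  rw [div_le_iff₀ (hpos k), add_mul, one_div, inv_mul_cancel₀ (hpos k).ne']
  push_cast
  gcongr
  exact Nat.floor_le (by positivity)

/-- Joint measurability is what Fubini needs. Rounding time up to a grid gives maps with countably
many time values, and right-continuity of the paths gives their pointwise convergence. -/
theorem CadlagPath.measurable_uncurry_comp {g : E → ℝ} (hg : Continuous g) (hgm : Measurable g) :
    Measurable (fun p : ℝ × CadlagPath E => g (p.2 p.1.toNNReal)) := by
  refine measurable_of_tendsto_metrizable (f := fun (k : ℕ) (p : ℝ × CadlagPath E) =>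
    g (p.2 (((⌊p.1.toNNReal * (k + 1)⌋₊ + 1 : ℕ) : ℝ≥0) / (k + 1)))) (fun k => ?_) ?_
  · have h1 : Measurable (fun q : ℕ × CadlagPath E => g (q.2 (((q.1 + 1 : ℕ) : ℝ≥0) / (k + 1)))) :=
      measurable_from_prod_countable_right fun m =>
        hgm.comp (CadlagPath.measurable_eval (((m + 1 : ℕ) : ℝ≥0) / (k + 1)))
    have h2 : Measurable (fun p : ℝ × CadlagPath E => (⌊p.1.toNNReal * ((k : ℝ≥0) + 1)⌋₊, p.2)) :=
      (Nat.measurable_floor.comp ((measurable_real_toNNReal.comp measurable_fst).mul_const _)).prodMk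
        measurable_snd
    exact h1.comp h2
  · refine tendsto_pi_nhds.2 fun p => ?_
    exact (hg.tendsto _).comp (((p.2.cadlag _).1.tendsto).comp
      (tendsto_floor_add_one_div_nhdsGE _))

/-- The expectation of `f` at the real time `s` (at time `0` if `s < 0`). -/
noncomputable def pathMean (P : Measure (CadlagPath E)) (f : E → ℝ) (s : ℝ) : ℝ :=
  ∫ ω, f (ω s.toNNReal) ∂P

/-- Continuous, measurable and bounded. -/
structure IsObservable (f : E → ℝ) : Prop where
  continuous : Continuous f
  measurable : Measurable f
  bounded : ∃ B, ∀ η, |f η| ≤ B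

variable {P : Measure (CadlagPath E)} {f g : E → ℝ}

theorem IsObservable.integrable [IsFiniteMeasure P] (hf : IsObservable f) (t : ℝ≥0) :
    Integrable (fun ω : CadlagPath E => f (ω t)) P := by
  obtain ⟨B, hB⟩ := hf.bounded
  exact Integrable.of_bound (hf.measurable.comp (CadlagPath.measurable_eval t)).aestronglyMeasurable
    B (Eventually.of_forall fun ω => hB _)

theorem IsObservable.measurable_pathMean [IsFiniteMeasure P] (hf : IsObservable f) :
    Measurable (pathMean P f) :=
  ((CadlagPath.measurable_uncurry_comp hf.continuous
    hf.measurable).stronglyMeasurable.integral_prod_right).measurable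

theorem abs_pathMean_le [IsProbabilityMeasure P] {B : ℝ} (hB : ∀ η, |f η| ≤ B) (s : ℝ) :
    |pathMean P f s| ≤ B := by
  have := norm_integral_le_of_norm_le_const (μ := P) (f := fun ω => f (ω s.toNNReal))
    (Eventually.of_forall fun ω => hB _)
  simpa [pathMean] using this

theorem pathMean_mono [IsFiniteMeasure P] (hf : IsObservable f) (hg : IsObservable g)
    (h : ∀ η, f η ≤ g η) (s : ℝ) : pathMean P f s ≤ pathMean P g s :=
  integral_mono (hf.integrable _) (hg.integrable _) fun _ => h _

theorem IsObservable.intervalIntegrable [IsProbabilityMeasure P] (hf : IsObservable f) (a b : ℝ) :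
    IntervalIntegrable (pathMean P f) volume a b := by
  obtain ⟨B, hB⟩ := hf.bounded
  refine (intervalIntegrable_const (c := B)).mono_fun
    hf.measurable_pathMean.aestronglyMeasurable (Eventually.of_forall fun s => ?_)
  exact (abs_pathMean_le hB s).trans (le_abs_self B)

theorem IsObservable.integrable_prod [IsProbabilityMeasure P] (hf : IsObservable f) (a b : ℝ) :
    Integrable (fun p : ℝ × CadlagPath E => f (p.2 p.1.toNNReal))
      ((volume.restrict (Set.uIoc a b)).prod P) := by
  have : IsFiniteMeasure (volume.restrict (Set.uIoc a b)) :=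
    ⟨by simp [Set.uIoc]⟩
  obtain ⟨B, hB⟩ := hf.bounded
  exact Integrable.of_bound (CadlagPath.measurable_uncurry_comp hf.continuous
    hf.measurable).aestronglyMeasurable B (Eventually.of_forall fun ω => hB _)

theorem IsObservable.integral_integral_swap [IsProbabilityMeasure P] (hf : IsObservable f)
    (a b : ℝ) :
    ∫ ω, (∫ s in a..b, f (ω s.toNNReal)) ∂P = ∫ s in a..b, pathMean P f s :=
  (intervalIntegral_integral_swap (hf.integrable_prod a b)).symm

theorem IsObservable.integrable_integral [IsProbabilityMeasure P] (hf : IsObservable f)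
    (a b : ℝ) : Integrable (fun ω : CadlagPath E => ∫ s in a..b, f (ω s.toNNReal)) P := by
  simp_rw [intervalIntegral.intervalIntegral_eq_integral_uIoc]
  exact ((hf.integrable_prod (P := P) a b).integral_prod_right).smul (if a ≤ b then (1 : ℝ) else -1)

variable {core : Set (E → ℝ)} {G : (E → ℝ) → E → ℝ} {μ : Measure E}

theorem SolvesMartingaleProblem.pathMean_eq (hP : SolvesMartingaleProblem core G μ P)
    (hc : f ∈ core) (hf : IsObservable f) (hG : IsObservable (G f)) {t : ℝ} (ht : 0 ≤ t) :
    pathMean P f t = pathMean P f 0 + ∫ s in (0 : ℝ)..t, pathMean P (G f) s := by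
  have := hP.isProbabilityMeasure
  have h := (hP.martingale f hc).setIntegral_eq (zero_le (a := t.toNNReal)) MeasurableSet.univ
  simp only [Measure.restrict_univ, sub_self, NNReal.coe_zero, intervalIntegral.integral_same,
    integral_zero, Real.coe_toNNReal t ht] at h
  have h1 := (hf.integrable (P := P) t.toNNReal).sub (hf.integrable 0)
  simp only [Pi.sub_def] at h1
  rw [integral_sub h1 (hG.integrable_integral 0 t),
    integral_sub (hf.integrable _) (hf.integrable _), hG.integral_integral_swap] at h
  unfold pathMean at h ⊢
  rw [Real.toNNReal_zero]
  linarith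

theorem SolvesMartingaleProblem.continuous_pathMean (hP : SolvesMartingaleProblem core G μ P)
    (hc : f ∈ core) (hf : IsObservable f) (hG : IsObservable (G f)) :
    Continuous (pathMean P f) := by
  have := hP.isProbabilityMeasure
  -- Negative times are read as time `0`, so the mean is constant there and continuity holds on all
  -- of `ℝ`.
  have h : pathMean P f = fun t => pathMean P f 0 + ∫ s in (0 : ℝ)..(max t 0), pathMean P (G f) s := by
    funext t
    rw [← hP.pathMean_eq hc hf hG (le_max_right t 0)]
    unfold pathMean
    congr 1
    funext ω
    rcases le_total t 0 with h | h
    · simp [h, Real.toNNReal_of_nonpos h]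
    · simp [h]
  rw [h]
  have := intervalIntegral.continuous_primitive (μ := volume)
    (fun a b => hG.intervalIntegrable (P := P) a b) 0
  exact continuous_const.add (this.comp (continuous_id.max continuous_const))

theorem SolvesMartingaleProblem.hasDerivAt_pathMean (hP : SolvesMartingaleProblem core G μ P)
    (hc : f ∈ core) (hf : IsObservable f) (hG : IsObservable (G f))
    (hcont : Continuous (pathMean P (G f))) {t : ℝ} (ht : 0 < t) :
    HasDerivAt (pathMean P f) (pathMean P (G f) t) t := by
  have h := ((intervalIntegral.integral_hasDerivAt_right (hcont.intervalIntegrable 0 t)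
    hcont.stronglyMeasurable.stronglyMeasurableAtFilter hcont.continuousAt).const_add
    (pathMean P f 0))
  refine h.congr_of_eventuallyEq ?_
  filter_upwards [lt_mem_nhds ht] with s hs
  exact hP.pathMean_eq hc hf hG hs.le

end PathExpectations

/-! ### The generators of the exclusion process and of the walk as one difference operator. -/

section Generators

/-- The generator of the walk on `{y ≥ x + 1}`, on functions of two integer variables. -/
noncomputable def pairGen (α : ℝ) (n : ℕ) (F : ℤ → ℤ → ℝ) (x y : ℤ) : ℝ :=
  bondRate α n (x - 1) * (F (x - 1) y - F x y) + bondRate α n y * (F x (y + 1) - F x y) +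
    if y = x + 1 then 0 else
      bondRate α n x * (F (x + 1) y - F x y) + bondRate α n (y - 1) * (F x (y - 1) - F x y)

theorem occ_exchange_left (η : Config) (x : ℤ) : occ (exchange η x) x = occ η (x + 1) := by
  simp [occ, exchange]

theorem occ_exchange_right (η : Config) (x : ℤ) : occ (exchange η x) (x + 1) = occ η x := by
  simp [occ, exchange]

theorem occ_exchange_pred (η : Config) (x : ℤ) :
    occ (exchange η (x - 1)) x = occ η (x - 1) := by
  simpa using occ_exchange_right η (x - 1)

theorem occ_exchange_of_ne (η : Config) {b x : ℤ} (h1 : x ≠ b) (h2 : x ≠ b + 1) :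
    occ (exchange η b) x = occ η x := by
  simp [occ, exchange, Equiv.swap_apply_of_ne_of_ne h1 h2]

theorem exclusionGen_occ (α : ℝ) (n : ℕ) (x : ℤ) (η : Config) :
    exclusionGen α n (fun η => occ η x) η =
      bondRate α n x * (occ η (x + 1) - occ η x) +
        bondRate α n (x - 1) * (occ η (x - 1) - occ η x) := by
  unfold exclusionGen
  beta_reduce
  rw [tsum_eq_sum (s := {x, x - 1})]
  · rw [Finset.sum_pair (by omega), occ_exchange_left, occ_exchange_pred]
  · intro b hb
    simp only [Finset.mem_insert, Finset.mem_singleton, not_or] at hb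
    rw [occ_exchange_of_ne η (x := x) (by omega) (by omega), sub_self, mul_zero]

/-- Only bonds touching `x` or `y` contribute. When `y = x + 1`, the exchange across the common bond
leaves the product unchanged, which is exactly the suppression of the two jumps out of `V`. -/
theorem exclusionGen_occ_mul (α : ℝ) (n : ℕ) {x y : ℤ} (hxy : x + 1 ≤ y) (η : Config) :
    exclusionGen α n (fun η => occ η x * occ η y) η =
      pairGen α n (fun a b => occ η a * occ η b) x y := by
  unfold exclusionGen pairGen
  beta_reduce
  rcases eq_or_ne y (x + 1) with rfl | hne
  · rw [tsum_eq_sum (s := {x - 1, x, x + 1})]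
    · rw [Finset.sum_insert (by simp; omega), Finset.sum_pair (by simp), occ_exchange_pred,
        occ_exchange_of_ne η (b := x - 1) (x := x + 1) (by omega) (by omega), occ_exchange_left,
        occ_exchange_right, occ_exchange_of_ne η (b := x + 1) (x := x) (by omega) (by omega),
        occ_exchange_left, if_pos rfl]
      ring
    · intro b hb
      simp only [Finset.mem_insert, Finset.mem_singleton, not_or] at hb
      rw [occ_exchange_of_ne η (x := x) (by omega) (by omega),
        occ_exchange_of_ne η (x := x + 1) (by omega) (by omega), sub_self, mul_zero]
  · rw [tsum_eq_sum (s := {x - 1, x, y - 1, y})]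
    · rw [Finset.sum_insert (by simp; omega), Finset.sum_insert (by simp; omega),
        Finset.sum_pair (by simp), occ_exchange_pred,
        occ_exchange_of_ne η (b := x - 1) (x := y) (by omega) (by omega), occ_exchange_left,
        occ_exchange_of_ne η (b := x) (x := y) (by omega) (by omega), occ_exchange_pred,
        occ_exchange_of_ne η (b := y - 1) (x := x) (by omega) (by omega), occ_exchange_left,
        occ_exchange_of_ne η (b := y) (x := x) (by omega) (by omega), if_neg hne]
      ring
    · intro b hb
      simp only [Finset.mem_insert, Finset.mem_singleton, not_or] at hb
      rw [occ_exchange_of_ne η (x := x) (by omega) (by omega),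
        occ_exchange_of_ne η (x := y) (by omega) (by omega), sub_self, mul_zero]

open Classical in
/-- The rate of the walk, on pairs of points of `ℤ²`. -/
noncomputable def planeRate (α : ℝ) (n : ℕ) (u v : ℤ × ℤ) : ℝ :=
  if |u.1 - v.1| + |u.2 - v.2| = 1 then
    if (u, v) ∈ slowEdges then α / n else 1
  else 0

theorem planeRate_left (α : ℝ) (n : ℕ) {x y : ℤ} (h : x + 1 ≤ y) :
    planeRate α n (x, y) (x - 1, y) = bondRate α n (x - 1) := by
  unfold planeRate bondRate
  rw [if_pos (by simp)]
  congr 1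
  simp [slowEdges, slowSites]
  omega

theorem planeRate_up (α : ℝ) (n : ℕ) {x y : ℤ} (h : x + 1 ≤ y) :
    planeRate α n (x, y) (x, y + 1) = bondRate α n y := by
  unfold planeRate bondRate
  rw [if_pos (by simp)]
  congr 1
  simp [slowEdges, slowSites]
  omega

theorem planeRate_right (α : ℝ) (n : ℕ) {x y : ℤ} (h : x + 2 ≤ y) :
    planeRate α n (x, y) (x + 1, y) = bondRate α n x := by
  unfold planeRate bondRate
  rw [if_pos (by simp)]
  congr 1
  simp [slowEdges, slowSites]
  omega

theorem planeRate_down (α : ℝ) (n : ℕ) {x y : ℤ} (h : x + 2 ≤ y) :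
    planeRate α n (x, y) (x, y - 1) = bondRate α n (y - 1) := by
  unfold planeRate bondRate
  rw [if_pos (by simp)]
  congr 1
  simp [slowEdges, slowSites]
  omega

/-- A slow edge is a jump of one coordinate across `{0,1}`, so each jump of the walk has the rate of
the bond crossed by the moving coordinate. -/
theorem walkGen_eq_pairGen (α : ℝ) (n : ℕ) (F : ℤ → ℤ → ℝ) (u : UpperV) :
    walkGen α n (fun v => F v.1.1 v.1.2) u = pairGen α n F u.1.1 u.1.2 := by
  obtain ⟨⟨x, y⟩, h⟩ := u
  simp only at h
  have h1 : walkGen α n (fun v => F v.1.1 v.1.2) ⟨(x, y), h⟩ =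
      ∑' v : {p : ℤ × ℤ | p.1 + 1 ≤ p.2},
        (fun p : ℤ × ℤ => planeRate α n (x, y) p * (F p.1 p.2 - F x y)) v := rfl
  rw [h1, tsum_subtype {p : ℤ × ℤ | p.1 + 1 ≤ p.2}
    (fun p : ℤ × ℤ => planeRate α n (x, y) p * (F p.1 p.2 - F x y)),
    tsum_eq_sum (s := {(x - 1, y), (x, y + 1), (x + 1, y), (x, y - 1)})]
  · rw [Finset.sum_insert (by simp; omega), Finset.sum_insert (by simp; omega),
      Finset.sum_pair (by simp)]
    simp only [Set.indicator_apply, Set.mem_ofPred_eq, pairGen]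
    rw [if_pos (by omega), if_pos (by omega), planeRate_left α n h, planeRate_up α n h]
    by_cases hy : y = x + 1
    · rw [if_neg (by omega), if_neg (by omega), if_pos hy]; ring
    · rw [if_pos (by omega), if_pos (by omega), if_neg hy, planeRate_right α n (by omega),
        planeRate_down α n (by omega)]; ring
  · rintro ⟨a, b⟩ hb
    simp only [Finset.mem_insert, Finset.mem_singleton, not_or, Prod.mk.injEq] at hb
    refine Set.indicator_apply_eq_zero.2 fun _ => ?_
    unfold planeRate
    rw [if_neg, zero_mul]
    simp only
    intro hh
    rcases abs_cases (x - a) with h3 | h3 <;> rcases abs_cases (y - b) with h4 | h4 <;> omega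

theorem bondRate_nonneg {α : ℝ} (hα : 0 ≤ α) (n : ℕ) (x : ℤ) : 0 ≤ bondRate α n x := by
  unfold bondRate
  split_ifs <;> positivity

theorem bondRate_le {α : ℝ} (hα : 0 ≤ α) (n : ℕ) (x : ℤ) : bondRate α n x ≤ 1 + α := by
  unfold bondRate
  split_ifs
  · rcases Nat.eq_zero_or_pos n with rfl | hn
    · simp; linarith
    · have : α / n ≤ α := div_le_self hα (by exact_mod_cast hn)
      linarith
  · linarith

/-- The commutator of `pairGen` with the multiplication by a slowly varying function. -/
theorem abs_pairGen_mul_sub_le {α : ℝ} (hα : 0 ≤ α) (n : ℕ) (χ F : ℤ → ℤ → ℝ) {B δ : ℝ}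
    {x y : ℤ} (hxy : x + 1 ≤ y) (hF : ∀ a b, a + 1 ≤ b → |F a b| ≤ B)
    (hχ₁ : ∀ a b, |χ (a + 1) b - χ a b| ≤ δ) (hχ₂ : ∀ a b, |χ a (b + 1) - χ a b| ≤ δ) :
    |pairGen α n (fun a b => χ a b * F a b) x y - χ x y * pairGen α n F x y| ≤
      4 * ((1 + α) * (δ * B)) := by
  have hδ : 0 ≤ δ := (abs_nonneg _).trans (hχ₁ 0 0)
  have hB : 0 ≤ B := (abs_nonneg _).trans (hF x y hxy)
  -- The commutator is a sum of at most four terms rate × (increment of `χ`) × (value of `F` at the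
  -- neighbour); this bounds each of them.
  have key : ∀ (c d f : ℝ), 0 ≤ c → c ≤ 1 + α → |d| ≤ δ → |f| ≤ B →
      |c * (d * f)| ≤ (1 + α) * (δ * B) := by
    intro c d f h0 h1 h2 h3
    rw [abs_mul, abs_mul, abs_of_nonneg h0]
    gcongr
  have hb0 := bondRate_nonneg hα n
  have hb1 := bondRate_le hα n
  have hpos : 0 ≤ (1 + α) * (δ * B) := by positivity
  have e1 := key _ (χ (x - 1) y - χ x y) (F (x - 1) y) (hb0 (x - 1)) (hb1 _)
    (by rw [abs_sub_comm]; simpa using hχ₁ (x - 1) y) (hF _ _ (by omega))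
  have e2 := key _ (χ x (y + 1) - χ x y) (F x (y + 1)) (hb0 y) (hb1 _) (hχ₂ _ _)
    (hF _ _ (by omega))
  unfold pairGen
  rw [abs_le] at e1 e2 ⊢
  split_ifs with h
  · constructor <;> linarith
  · have e3 := key _ (χ (x + 1) y - χ x y) (F (x + 1) y) (hb0 x) (hb1 _) (hχ₁ _ _)
      (hF _ _ (by omega))
    have e4 := key _ (χ x (y - 1) - χ x y) (F x (y - 1)) (hb0 (y - 1)) (hb1 _)
      (by rw [abs_sub_comm]; simpa using hχ₂ x (y - 1)) (hF _ _ (by omega))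
    rw [abs_le] at e3 e4
    constructor <;> linarith

end Generators

/-! ### Maximum principle on an infinite index set. -/

/-- A maximum principle for bounded solutions: at the indices in `Z` the bound `M` is given, at the
others the derivative is at most `R` times the gap to any upper bound. -/
theorem le_of_deriv_le_mul_gap {ι : Type*} (Z : Set ι) {w d : ℝ → ι → ℝ} {T R B M : ℝ}
    (hR : 0 ≤ R) (hB : ∀ t ∈ Set.Icc 0 T, ∀ x, w t x ≤ B)
    (hZ : ∀ x ∈ Z, ∀ t ∈ Set.Icc 0 T, w t x ≤ M)
    (h0 : ∀ x, w 0 x ≤ M)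
    (hcont : ∀ x ∉ Z, ContinuousOn (fun t => w t x) (Set.Icc 0 T))
    (hderiv : ∀ x ∉ Z, ∀ t ∈ Set.Ioo 0 T, HasDerivAt (fun t => w t x) (d t x) t)
    (hd : ∀ x ∉ Z, ∀ t ∈ Set.Ioo 0 T, ∀ S, M ≤ S → (∀ y, w t y ≤ S) → d t x ≤ R * (S - w t x)) :
    ∀ t ∈ Set.Icc 0 T, ∀ x, w t x ≤ M := by
  rcases lt_or_ge T 0 with hT | hT
  · intro t ht; exact absurd (ht.1.trans ht.2) hT.not_ge
  -- The supremum over the indices need not be attained, so the bound is improved iteratively. If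
  -- `S` bounds `w`, then `e^{Rt} (w - S)` is nonincreasing, and the excess `S - M` shrinks by the
  -- fixed factor `1 - e^{-RT} < 1`.
  have step : ∀ S, M ≤ S → (∀ t ∈ Set.Icc 0 T, ∀ x, w t x ≤ S) →
      ∀ t ∈ Set.Icc 0 T, ∀ x, w t x ≤ M + (1 - Real.exp (-(R * T))) * (S - M) := by
    intro S hMS hS t ht x
    have hfac : 0 ≤ 1 - Real.exp (-(R * T)) := by
      have : Real.exp (-(R * T)) ≤ 1 := Real.exp_le_one_iff.2 (by nlinarith)
      linarith
    by_cases hx : x ∈ Z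
    · have := hZ x hx t ht
      nlinarith [mul_nonneg hfac (sub_nonneg.2 hMS)]
    have hexp : ∀ s : ℝ, HasDerivAt (fun s => Real.exp (R * s)) (Real.exp (R * s) * R) s := by
      intro s
      simpa using ((hasDerivAt_id s).const_mul R).exp
    have hder : ∀ s ∈ Set.Ioo 0 T, HasDerivAt (fun s => Real.exp (R * s) * (w s x - S))
        (Real.exp (R * s) * R * (w s x - S) + Real.exp (R * s) * d s x) s := fun s hs =>
      (hexp s).mul ((hderiv x hx s hs).sub_const S)
    have hanti : AntitoneOn (fun s => Real.exp (R * s) * (w s x - S)) (Set.Icc 0 T) := by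
      refine antitoneOn_of_deriv_nonpos (convex_Icc 0 T) ?_ ?_ ?_
      · exact (by fun_prop : Continuous fun s => Real.exp (R * s)).continuousOn.mul
          ((hcont x hx).sub continuousOn_const)
      · rw [interior_Icc]
        exact fun s hs => (hder s hs).differentiableAt.differentiableWithinAt
      · rw [interior_Icc]
        intro s hs
        rw [(hder s hs).deriv]
        have h1 := hd x hx s hs S hMS (hS s (Set.Ioo_subset_Icc_self hs))
        nlinarith [mul_le_mul_of_nonneg_left h1 (Real.exp_pos (R * s)).le]
    have h1 := hanti (Set.left_mem_Icc.2 hT) ht ht.1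
    simp only [mul_zero, Real.exp_zero, one_mul] at h1
    have h2 : Real.exp (R * t) * (w t x - S) ≤ M - S := h1.trans (by linarith [h0 x])
    have h3 : w t x - S ≤ Real.exp (-(R * t)) * (M - S) := by
      have := mul_le_mul_of_nonneg_left h2 (Real.exp_pos (-(R * t))).le
      rwa [← mul_assoc, ← Real.exp_add, neg_add_cancel, Real.exp_zero, one_mul] at this
    have h4 : Real.exp (-(R * T)) ≤ Real.exp (-(R * t)) :=
      Real.exp_le_exp.2 (by nlinarith [ht.2])
    nlinarith [mul_le_mul_of_nonneg_right h4 (sub_nonneg.2 hMS)]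
  have iter : ∀ k : ℕ, ∀ t ∈ Set.Icc 0 T, ∀ x,
      w t x ≤ M + (1 - Real.exp (-(R * T))) ^ k * (max B M - M) := by
    have hfac : 0 ≤ 1 - Real.exp (-(R * T)) := by
      have : Real.exp (-(R * T)) ≤ 1 := Real.exp_le_one_iff.2 (by nlinarith)
      linarith
    intro k
    induction k with
    | zero =>
      intro t ht x
      simpa using (hB t ht x).trans (le_max_left B M)
    | succ k ih =>
      intro t ht x
      have := step _ (le_add_of_nonneg_right
        (mul_nonneg (pow_nonneg hfac k) (sub_nonneg.2 (le_max_right B M)))) ih t ht x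
      rw [add_sub_cancel_left, ← mul_assoc, ← pow_succ'] at this
      exact this
  intro t ht x
  have hlim : Tendsto (fun k : ℕ => M + (1 - Real.exp (-(R * T))) ^ k * (max B M - M)) atTop
      (𝓝 (M + 0 * (max B M - M))) := by
    refine tendsto_const_nhds.add (Tendsto.mul_const _ (tendsto_pow_atTop_nhds_zero_of_lt_one ?_ ?_))
    · have : Real.exp (-(R * T)) ≤ 1 := Real.exp_le_one_iff.2 (by nlinarith)
      linarith
    · linarith [Real.exp_pos (-(R * T))]
  rw [zero_mul, add_zero] at hlim
  exact ge_of_tendsto' hlim fun k => iter k t ht x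

/-! ### Algebra of bounded continuous observables. -/

section Observables

variable {E : Type*} [TopologicalSpace E] [MeasurableSpace E] {P : Measure (CadlagPath E)}
  {f g : E → ℝ}

theorem IsObservable.add (hf : IsObservable f) (hg : IsObservable g) :
    IsObservable (fun η => f η + g η) where
  continuous := hf.continuous.add hg.continuous
  measurable := hf.measurable.add hg.measurable
  bounded := by
    obtain ⟨B, hB⟩ := hf.bounded
    obtain ⟨B', hB'⟩ := hg.bounded
    exact ⟨B + B', fun η => (abs_add_le _ _).trans (add_le_add (hB η) (hB' η))⟩

theorem IsObservable.mul (hf : IsObservable f) (hg : IsObservable g) :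
    IsObservable (fun η => f η * g η) where
  continuous := hf.continuous.mul hg.continuous
  measurable := hf.measurable.mul hg.measurable
  bounded := by
    obtain ⟨B, hB⟩ := hf.bounded
    obtain ⟨B', hB'⟩ := hg.bounded
    refine ⟨B * B', fun η => ?_⟩
    rw [abs_mul]
    exact mul_le_mul (hB η) (hB' η) (abs_nonneg _) ((abs_nonneg _).trans (hB η))

theorem isObservable_const (c : ℝ) : IsObservable (fun _ : E => c) :=
  ⟨continuous_const, measurable_const, |c|, fun _ => le_rfl⟩

theorem IsObservable.const_mul (hf : IsObservable f) (c : ℝ) : IsObservable (fun η => c * f η) :=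
  (isObservable_const c).mul hf

theorem IsObservable.sub (hf : IsObservable f) (hg : IsObservable g) :
    IsObservable (fun η => f η - g η) := by
  simpa [sub_eq_add_neg] using hf.add (hg.const_mul (-1))

theorem pathMean_add [IsFiniteMeasure P] (hf : IsObservable f) (hg : IsObservable g) (s : ℝ) :
    pathMean P (fun η => f η + g η) s = pathMean P f s + pathMean P g s :=
  integral_add (hf.integrable _) (hg.integrable _)

theorem pathMean_sub [IsFiniteMeasure P] (hf : IsObservable f) (hg : IsObservable g) (s : ℝ) :
    pathMean P (fun η => f η - g η) s = pathMean P f s - pathMean P g s :=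
  integral_sub (hf.integrable _) (hg.integrable _)

theorem pathMean_const_mul (c : ℝ) (s : ℝ) :
    pathMean P (fun η => c * f η) s = c * pathMean P f s :=
  integral_const_mul _ _

theorem pathMean_const [IsProbabilityMeasure P] (c s : ℝ) :
    pathMean P (fun _ => c) s = c := by
  simp [pathMean]

theorem abs_pathMean_le_pathMean [IsFiniteMeasure P] (hg : IsObservable g)
    (h : ∀ η, |f η| ≤ g η) (s : ℝ) : |pathMean P f s| ≤ pathMean P g s :=
  norm_integral_le_of_norm_le (f := fun ω : CadlagPath E => f (ω s.toNNReal)) (hg.integrable s.toNNReal)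
    (Eventually.of_forall fun _ => h _)

theorem IsObservable.pairGen {F : ℤ → ℤ → E → ℝ} (hF : ∀ a b, IsObservable (F a b)) (α : ℝ) (n : ℕ)
    (x y : ℤ) : IsObservable (fun η => pairGen α n (fun a b => F a b η) x y) := by
  unfold _root_.pairGen
  refine ((((hF _ _).sub (hF _ _)).const_mul _).add (((hF _ _).sub (hF _ _)).const_mul _)).add ?_
  split_ifs
  · exact isObservable_const 0
  · exact (((hF _ _).sub (hF _ _)).const_mul _).add (((hF _ _).sub (hF _ _)).const_mul _)

theorem pathMean_pairGen [IsProbabilityMeasure P] {F : ℤ → ℤ → E → ℝ}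
    (hF : ∀ a b, IsObservable (F a b)) (α : ℝ) (n : ℕ) (x y : ℤ) (s : ℝ) :
    pathMean P (fun η => pairGen α n (fun a b => F a b η) x y) s =
      pairGen α n (fun a b => pathMean P (F a b) s) x y := by
  have hd : ∀ c a b a' b', IsObservable (fun η => c * (F a b η - F a' b' η)) :=
    fun c a b a' b' => ((hF a b).sub (hF a' b')).const_mul c
  unfold pairGen
  split_ifs
  · simp only [add_zero]
    rw [pathMean_add (hd _ _ _ _ _) (hd _ _ _ _ _), pathMean_const_mul, pathMean_const_mul,
      pathMean_sub (hF _ _) (hF _ _), pathMean_sub (hF _ _) (hF _ _)]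
  · rw [pathMean_add ((hd _ _ _ _ _).add (hd _ _ _ _ _)) ((hd _ _ _ _ _).add (hd _ _ _ _ _)),
      pathMean_add (hd _ _ _ _ _) (hd _ _ _ _ _), pathMean_add (hd _ _ _ _ _) (hd _ _ _ _ _)]
    simp only [pathMean_const_mul, pathMean_sub (hF _ _) (hF _ _)]

theorem continuous_pairGen {X : Type*} [TopologicalSpace X] {F : X → ℤ → ℤ → ℝ}
    (hF : ∀ a b, Continuous fun s => F s a b) (α : ℝ) (n : ℕ) (x y : ℤ) :
    Continuous fun s => pairGen α n (F s) x y := by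
  unfold pairGen
  split_ifs <;> fun_prop

end Observables

/-! ### Evolution of densities, correlations and currents. -/

section Exclusion

theorem continuous_occ (x : ℤ) : Continuous fun η : Config => occ η x :=
  (continuous_of_discreteTopology (f := fun b : Bool => if b then (1 : ℝ) else 0)).comp
    (continuous_apply x)

theorem measurable_occ (x : ℤ) : Measurable fun η : Config => occ η x :=
  (measurable_of_countable (fun b : Bool => if b then (1 : ℝ) else 0)).comp (measurable_pi_apply x)

theorem occ_mem_Icc (η : Config) (x : ℤ) : occ η x ∈ Set.Icc (0 : ℝ) 1 := by
  unfold occ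
  split_ifs <;> simp

theorem isObservable_occ (x : ℤ) : IsObservable fun η : Config => occ η x :=
  ⟨continuous_occ x, measurable_occ x, 1, fun η => abs_le.2
    ⟨by linarith [(occ_mem_Icc η x).1], (occ_mem_Icc η x).2⟩⟩

theorem isObservable_occ_mul (x y : ℤ) : IsObservable fun η : Config => occ η x * occ η y :=
  (isObservable_occ x).mul (isObservable_occ y)

theorem occ_mem_localFunctions (x : ℤ) : (fun η : Config => occ η x) ∈ localFunctions :=
  ⟨{x}, fun η η' h => by simp [occ, h x (by simp)]⟩

theorem occ_mul_mem_localFunctions (x y : ℤ) :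
    (fun η : Config => occ η x * occ η y) ∈ localFunctions :=
  ⟨{x, y}, fun η η' h => by simp [occ, h x (by simp), h y (by simp)]⟩

variable {α : ℝ} {n : ℕ} {μ : Measure Config} {P : Measure (CadlagPath Config)}

/-- The mean occupation at time `s`. -/
noncomputable def occMean (P : Measure (CadlagPath Config)) (s : ℝ) (x : ℤ) : ℝ :=
  pathMean P (fun η => occ η x) s

/-- The truncated two-point correlation at time `s`. -/
noncomputable def occCorr (P : Measure (CadlagPath Config)) (s : ℝ) (x y : ℤ) : ℝ :=
  pathMean P (fun η => occ η x * occ η y) s - occMean P s x * occMean P s y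

theorem siteMean_lawAt (x : ℤ) (t : ℝ≥0) : siteMean (lawAt P t) x = occMean P t x := by
  unfold siteMean lawAt occMean pathMean
  rw [integral_map (CadlagPath.measurable_eval t).aemeasurable
    (measurable_occ x).aestronglyMeasurable, Real.toNNReal_coe]

theorem siteCorr_lawAt (x y : ℤ) (t : ℝ≥0) : siteCorr (lawAt P t) x y = occCorr P t x y := by
  unfold siteCorr
  rw [siteMean_lawAt, siteMean_lawAt]
  unfold lawAt occCorr pathMean
  rw [integral_map (CadlagPath.measurable_eval t).aemeasurable
    (isObservable_occ_mul x y).measurable.aestronglyMeasurable, Real.toNNReal_coe]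

theorem occMean_mem_Icc [IsProbabilityMeasure P] (s : ℝ) (x : ℤ) :
    occMean P s x ∈ Set.Icc (0 : ℝ) 1 := by
  constructor
  · exact integral_nonneg fun ω => (occ_mem_Icc _ _).1
  · have := pathMean_mono (P := P) (isObservable_occ x) (isObservable_const 1)
      (fun η => (occ_mem_Icc η x).2) s
    rwa [pathMean_const] at this

theorem abs_occCorr_le [IsProbabilityMeasure P] (s : ℝ) (x y : ℤ) : |occCorr P s x y| ≤ 2 := by
  have h1 := abs_pathMean_le (P := P) (f := fun η : Config => occ η x * occ η y) (B := 1)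
    (fun η => by
      rw [abs_of_nonneg (mul_nonneg (occ_mem_Icc η x).1 (occ_mem_Icc η y).1)]
      exact mul_le_one₀ (occ_mem_Icc η x).2 (occ_mem_Icc η y).1 (occ_mem_Icc η y).2) s
  have hx := occMean_mem_Icc (P := P) s x
  have hy := occMean_mem_Icc (P := P) s y
  have h2 : occMean P s x * occMean P s y ≤ 1 := mul_le_one₀ hx.2 hy.1 hy.2
  have h3 := mul_nonneg hx.1 hy.1
  unfold occCorr
  rw [abs_le] at h1 ⊢
  constructor <;> linarith

theorem isObservable_exclusionGen_occ (α : ℝ) (n : ℕ) (x : ℤ) :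
    IsObservable fun η => (n : ℝ) ^ 2 * exclusionGen α n (fun η => occ η x) η := by
  simp_rw [exclusionGen_occ]
  exact ((((isObservable_occ _).sub (isObservable_occ _)).const_mul _).add
    (((isObservable_occ _).sub (isObservable_occ _)).const_mul _)).const_mul _

theorem isObservable_exclusionGen_occ_mul (α : ℝ) (n : ℕ) {x y : ℤ} (hxy : x + 1 ≤ y) :
    IsObservable fun η => (n : ℝ) ^ 2 * exclusionGen α n (fun η => occ η x * occ η y) η := by
  simp_rw [exclusionGen_occ_mul α n hxy]
  exact (IsObservable.pairGen isObservable_occ_mul α n x y).const_mul _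

theorem IsSlowBondExclusion.continuous_occMean (hP : IsSlowBondExclusion α n μ P) (x : ℤ) :
    Continuous fun s => occMean P s x :=
  hP.continuous_pathMean (occ_mem_localFunctions x) (isObservable_occ x)
    (isObservable_exclusionGen_occ α n x)

theorem IsSlowBondExclusion.hasDerivAt_occMean (hP : IsSlowBondExclusion α n μ P) (x : ℤ) {t : ℝ}
    (ht : 0 < t) : HasDerivAt (fun s => occMean P s x)
      ((n : ℝ) ^ 2 * (bondRate α n x * (occMean P t (x + 1) - occMean P t x) +
        bondRate α n (x - 1) * (occMean P t (x - 1) - occMean P t x))) t := by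
  have := hP.isProbabilityMeasure
  have h : ∀ s, pathMean P (fun η => (n : ℝ) ^ 2 * exclusionGen α n (fun η => occ η x) η) s =
      (n : ℝ) ^ 2 * (bondRate α n x * (occMean P s (x + 1) - occMean P s x) +
        bondRate α n (x - 1) * (occMean P s (x - 1) - occMean P s x)) := by
    intro s
    simp_rw [exclusionGen_occ]
    rw [pathMean_const_mul,
      pathMean_add (((isObservable_occ _).sub (isObservable_occ _)).const_mul _)
        (((isObservable_occ _).sub (isObservable_occ _)).const_mul _),
      pathMean_const_mul, pathMean_const_mul,
      pathMean_sub (isObservable_occ _) (isObservable_occ _),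
      pathMean_sub (isObservable_occ _) (isObservable_occ _)]
    rfl
  rw [← h t]
  refine hP.hasDerivAt_pathMean (occ_mem_localFunctions x) (isObservable_occ x)
    (isObservable_exclusionGen_occ α n x) ?_ ht
  rw [funext h]
  have h0 := hP.continuous_occMean x
  have h1 := hP.continuous_occMean (x + 1)
  have h2 := hP.continuous_occMean (x - 1)
  fun_prop

/-- All pairs are covered, including `x = y` (where `η(x)² = η(x)`) and `x > y`, because
`continuous_pairGen` asks for continuity on the whole of `ℤ²`. -/
theorem IsSlowBondExclusion.continuous_occ_mul (hP : IsSlowBondExclusion α n μ P) (x y : ℤ) :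
    Continuous (pathMean P fun η => occ η x * occ η y) := by
  rcases lt_trichotomy x y with h | rfl | h
  · exact hP.continuous_pathMean (occ_mul_mem_localFunctions x y) (isObservable_occ_mul x y)
      (isObservable_exclusionGen_occ_mul α n h)
  · have : (fun η : Config => occ η x * occ η x) = fun η => occ η x := by
      funext η
      unfold occ
      split_ifs <;> simp
    rw [this]
    exact hP.continuous_occMean x
  · simp_rw [mul_comm (occ _ x)]
    exact hP.continuous_pathMean (occ_mul_mem_localFunctions y x) (isObservable_occ_mul y x)
      (isObservable_exclusionGen_occ_mul α n h)

theorem IsSlowBondExclusion.continuous_occCorr (hP : IsSlowBondExclusion α n μ P) (x y : ℤ) :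
    Continuous fun s => occCorr P s x y :=
  (hP.continuous_occ_mul x y).sub ((hP.continuous_occMean x).mul (hP.continuous_occMean y))

/-- The defect between the product of two one-particle evolutions and the exclusion evolution. -/
theorem pairGen_sub_mul (α : ℝ) (n : ℕ) (F : ℤ → ℤ → ℝ) (r : ℤ → ℝ) (x y : ℤ) :
    pairGen α n (fun a b => F a b - r a * r b) x y -
        (if y = x + 1 then bondRate α n x * (r (x + 1) - r x) ^ 2 else 0) =
      pairGen α n F x y -
        ((bondRate α n x * (r (x + 1) - r x) + bondRate α n (x - 1) * (r (x - 1) - r x)) * r y +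
          r x * (bondRate α n y * (r (y + 1) - r y) +
            bondRate α n (y - 1) * (r (y - 1) - r y))) := by
  unfold pairGen
  split_ifs with h
  -- On the diagonal the product evolution keeps the two jumps across the common bond; together they
  -- contribute `ξ (r(x+1) - r(x)) r(x+1) + r(x) ξ (r(x) - r(x+1))`, a perfect square times the
  -- rate.
  · subst h
    rw [add_sub_cancel_right]
    ring
  · ring

theorem IsSlowBondExclusion.hasDerivAt_occCorr (hP : IsSlowBondExclusion α n μ P) {x y : ℤ}
    (hxy : x + 1 ≤ y) {t : ℝ} (ht : 0 < t) : HasDerivAt (fun s => occCorr P s x y)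
      ((n : ℝ) ^ 2 * (pairGen α n (occCorr P t) x y -
        if y = x + 1 then bondRate α n x * (occMean P t (x + 1) - occMean P t x) ^ 2 else 0)) t := by
  have := hP.isProbabilityMeasure
  have h : ∀ s, pathMean P (fun η => (n : ℝ) ^ 2 *
      exclusionGen α n (fun η => occ η x * occ η y) η) s =
      (n : ℝ) ^ 2 * pairGen α n (fun a b => pathMean P (fun η => occ η a * occ η b) s) x y := by
    intro s
    simp_rw [exclusionGen_occ_mul α n hxy]
    rw [pathMean_const_mul, pathMean_pairGen isObservable_occ_mul]
  have h1 : HasDerivAt (pathMean P fun η => occ η x * occ η y)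
      ((n : ℝ) ^ 2 * pairGen α n (fun a b => pathMean P (fun η => occ η a * occ η b) t) x y) t := by
    rw [← h t]
    refine hP.hasDerivAt_pathMean (occ_mul_mem_localFunctions x y) (isObservable_occ_mul x y)
      (isObservable_exclusionGen_occ_mul α n hxy) ?_ ht
    rw [funext h]
    exact continuous_const.mul (continuous_pairGen hP.continuous_occ_mul α n x y)
  have h2 := h1.sub ((hP.hasDerivAt_occMean x ht).mul (hP.hasDerivAt_occMean y ht))
  have h3 := pairGen_sub_mul α n (fun a b => pathMean P (fun η => occ η a * occ η b) t)
    (occMean P t) x y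
  refine HasDerivAt.congr_deriv h2 (Eq.symm ?_)
  change (n : ℝ) ^ 2 * (pairGen α n (fun a b => pathMean P (fun η => occ η a * occ η b) t -
    occMean P t a * occMean P t b) x y - _) = _
  rw [h3]
  ring

/-- Upper bound on the currents of a solution of the heat equation with a slow bond. -/
theorem current_le (hα : 0 ≤ α) {ρ : ℝ → ℤ → ℝ} (hρ : ∀ s x, |ρ s x| ≤ 1)
    (hcont : ∀ x, Continuous fun s => ρ s x)
    (hder : ∀ x t, 0 < t → HasDerivAt (fun s => ρ s x)
      ((n : ℝ) ^ 2 * (bondRate α n x * (ρ t (x + 1) - ρ t x) +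
        bondRate α n (x - 1) * (ρ t (x - 1) - ρ t x))) t) {M : ℝ}
    (hM : ∀ s, bondRate α n 0 * (ρ s 1 - ρ s 0) ≤ M)
    (h0 : ∀ x, bondRate α n x * (ρ 0 (x + 1) - ρ 0 x) ≤ M) {t : ℝ} (ht : 0 ≤ t) (x : ℤ) :
    bondRate α n x * (ρ t (x + 1) - ρ t x) ≤ M := by
  -- Off the slow bond the rate is `1` and the currents satisfy the closed equation `∂ₜJ_x = n²
  -- (J_{x+1} - 2 J_x + J_{x-1})`, whatever the rates of the neighbouring bonds. Replacing both
  -- neighbours by an upper bound `S` gives `2n² (S - J_x)`, hence the value of `R`; bond `0` is the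
  -- boundary.
  refine le_of_deriv_le_mul_gap {0} (T := t) (R := 2 * (n : ℝ) ^ 2) (B := (1 + α) * 2)
    (w := fun s x => bondRate α n x * (ρ s (x + 1) - ρ s x))
    (d := fun s x => (n : ℝ) ^ 2 * (bondRate α n (x + 1) * (ρ s (x + 1 + 1) - ρ s (x + 1)) -
      2 * (bondRate α n x * (ρ s (x + 1) - ρ s x)) +
        bondRate α n (x - 1) * (ρ s (x - 1 + 1) - ρ s (x - 1))))
    (by positivity) ?_ ?_ h0 ?_ ?_ ?_ t ⟨ht, le_rfl⟩ x
  · intro s _ x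
    refine (mul_le_mul_of_nonneg_left (b := ρ s (x + 1) - ρ s x) (c := 2) ?_
      (bondRate_nonneg hα n x)).trans ?_
    · linarith [(abs_le.1 (hρ s (x + 1))).2, (abs_le.1 (hρ s x)).1]
    · exact mul_le_mul_of_nonneg_right (bondRate_le hα n x) (by norm_num)
  · rintro x rfl s _
    exact hM s
  · intro x _
    have h1 := hcont x
    have h2 := hcont (x + 1)
    exact Continuous.continuousOn (by fun_prop)
  · intro x hx s hs
    have hx1 : bondRate α n x = 1 := if_neg hx
    have h := ((hder (x + 1) s hs.1).sub (hder x s hs.1)).const_mul (bondRate α n x)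
    refine HasDerivAt.congr_deriv h ?_
    rw [add_sub_cancel_right, sub_add_cancel, hx1]
    ring
  · intro x _ s _ S _ hS
    have h1 := hS (x + 1)
    have h2 := hS (x - 1)
    have : 0 ≤ (n : ℝ) ^ 2 := by positivity
    nlinarith

theorem IsSlowBondExclusion.abs_current_le (hα : 0 ≤ α) (hP : IsSlowBondExclusion α n μ P) {M : ℝ}
    (hM : α / n ≤ M)
    (h0 : ∀ x : ℤ, x ≠ 0 → |siteMean μ (x + 1) - siteMean μ x| ≤ M) {t : ℝ} (ht : 0 ≤ t) (x : ℤ) :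
    |bondRate α n x * (occMean P t (x + 1) - occMean P t x)| ≤ M := by
  have := hP.isProbabilityMeasure
  have hzero : ∀ s, |bondRate α n 0 * (occMean P s 1 - occMean P s 0)| ≤ M := by
    intro s
    have h1 := occMean_mem_Icc (P := P) s 1
    have h2 := occMean_mem_Icc (P := P) s 0
    rw [abs_mul, abs_of_nonneg (bondRate_nonneg hα n 0)]
    refine (mul_le_of_le_one_right (bondRate_nonneg hα n 0) ?_).trans
      (le_of_eq_of_le (if_pos rfl) hM)
    rw [abs_le]
    constructor <;> linarith [h1.1, h1.2, h2.1, h2.2]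
  have hinit : ∀ x, |bondRate α n x * (occMean P 0 (x + 1) - occMean P 0 x)| ≤ M := by
    intro x
    by_cases hx : x = 0
    · subst hx; exact hzero 0
    · have hμ : lawAt P 0 = μ := hP.initial
      have h1 := siteMean_lawAt (P := P) x 0
      have h2 := siteMean_lawAt (P := P) (x + 1) 0
      rw [hμ, NNReal.coe_zero] at h1 h2
      rw [bondRate, if_neg hx, one_mul, ← h1, ← h2]
      exact h0 x hx
  have hocc : ∀ s x, |occMean P s x| ≤ 1 := fun s x => by
    rw [abs_of_nonneg (occMean_mem_Icc s x).1]; exact (occMean_mem_Icc s x).2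
  refine abs_le.2 ⟨?_, ?_⟩
  -- The equation is linear, so the lower bound is the upper bound for `-ρ`.
  · have h := current_le (n := n) hα (ρ := fun s x => -occMean P s x) (M := M)
      (fun s x => by rw [abs_neg]; exact hocc s x) (fun x => (hP.continuous_occMean x).neg)
      (fun x s hs => (hP.hasDerivAt_occMean x hs).fun_neg.congr_deriv (by ring))
      (fun s => by linarith [(abs_le.1 (hzero s)).1])
      (fun x => by linarith [(abs_le.1 (hinit x)).1]) ht x
    linarith
  · exact current_le hα hocc hP.continuous_occMean (fun x s hs => hP.hasDerivAt_occMean x hs)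
      (fun s => (abs_le.1 (hzero s)).2) (fun x => (abs_le.1 (hinit x)).2) ht x

end Exclusion

/-! ### Duhamel's formula for the walk, by localization. -/

section Walk

theorem UpperV.finite_support_iff {f : UpperV → ℝ} :
    (Function.support f).Finite ↔ ∃ R : ℤ, ∀ v : UpperV, R ≤ |v.1.1| + |v.1.2| → f v = 0 := by
  constructor
  · intro h
    obtain ⟨R, hR⟩ := (h.image fun v : UpperV => |v.1.1| + |v.1.2|).bddAbove
    refine ⟨R + 1, fun v hv => ?_⟩
    by_contra hne
    have := hR ⟨v, hne, rfl⟩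
    simp only at this
    omega
  · rintro ⟨R, hR⟩
    refine Set.Finite.subset (s := Subtype.val ⁻¹' (Set.Icc (-R) R ×ˢ Set.Icc (-R) R))
      (((Set.finite_Icc _ _).prod (Set.finite_Icc _ _)).preimage
        Subtype.val_injective.injOn) fun v hv => ?_
    have h : |v.1.1| + |v.1.2| < R := not_le.1 fun h => hv (hR v h)
    have h1 := abs_nonneg v.1.1
    have h2 := abs_nonneg v.1.2
    exact ⟨abs_le.1 (by omega), abs_le.1 (by omega)⟩

/-- Extension by zero from `V` to `ℤ²`. -/
def UpperV.extend (f : UpperV → ℝ) (a b : ℤ) : ℝ := if h : a + 1 ≤ b then f ⟨(a, b), h⟩ else 0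

theorem UpperV.extend_coe (f : UpperV → ℝ) (v : UpperV) : UpperV.extend f v.1.1 v.1.2 = f v :=
  dif_pos v.2

theorem walkGen_apply (α : ℝ) (n : ℕ) (f : UpperV → ℝ) (u : UpperV) :
    walkGen α n f u = pairGen α n (UpperV.extend f) u.1.1 u.1.2 := by
  rw [← walkGen_eq_pairGen]
  simp_rw [UpperV.extend_coe]

/-- Jumps have length one, so the support grows by at most one layer. The core is thus stable under
the generator, which makes the means of core functions differentiable with continuous derivative at
positive times. -/
theorem UpperV.finite_support_walkGen (α : ℝ) (n : ℕ) {f : UpperV → ℝ}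
    (hf : (Function.support f).Finite) : (Function.support (walkGen α n f)).Finite := by
  obtain ⟨R, hR⟩ := UpperV.finite_support_iff.1 hf
  refine UpperV.finite_support_iff.2 ⟨R + 1, fun v hv => ?_⟩
  have h0 : ∀ a b : ℤ, R ≤ |a| + |b| → UpperV.extend f a b = 0 := fun a b hab => by
    unfold UpperV.extend
    split_ifs with h
    · exact hR _ hab
    · rfl
  have h1 : ∀ a : ℤ, |a| - 1 ≤ |a - 1| ∧ |a| - 1 ≤ |a + 1| := fun a => by
    constructor
    · have := abs_sub_abs_le_abs_sub a 1
      have := abs_sub_abs_le_abs_sub a (a - 1)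
      rw [sub_sub_cancel, abs_one] at this
      omega
    · have := abs_sub_abs_le_abs_sub a (a + 1)
      rw [sub_add_cancel_left, abs_neg, abs_one] at this
      omega
  have hx := h1 v.1.1
  have hy := h1 v.1.2
  rw [walkGen_apply, pairGen, h0 v.1.1 v.1.2 (by omega), h0 (v.1.1 - 1) _ (by omega),
    h0 _ (v.1.2 + 1) (by omega), h0 (v.1.1 + 1) _ (by omega), h0 _ (v.1.2 - 1) (by omega)]
  simp

theorem UpperV.isObservable {f : UpperV → ℝ} (h : ∃ B, ∀ v, |f v| ≤ B) : IsObservable f :=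
  ⟨continuous_of_discreteTopology, measurable_of_countable f, h⟩

theorem UpperV.isObservable_of_finite_support {f : UpperV → ℝ}
    (h : (Function.support f).Finite) : IsObservable f := by
  refine UpperV.isObservable ?_
  obtain ⟨B, hB⟩ := (h.image fun v => |f v|).bddAbove
  refine ⟨max B 0, fun v => ?_⟩
  by_cases hv : f v = 0
  · simp [hv]
  · exact (hB ⟨v, hv, rfl⟩).trans (le_max_left _ _)

variable {α : ℝ} {n : ℕ} {z : UpperV} {Q : Measure (CadlagPath UpperV)}

theorem IsSlowBondWalk.continuous_pathMean (hQ : IsSlowBondWalk α n z Q) {f : UpperV → ℝ}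
    (hf : (Function.support f).Finite) : Continuous (pathMean Q f) :=
  SolvesMartingaleProblem.continuous_pathMean hQ hf (UpperV.isObservable_of_finite_support hf)
    (UpperV.isObservable_of_finite_support (UpperV.finite_support_walkGen α n hf))

theorem IsSlowBondWalk.hasDerivAt_pathMean (hQ : IsSlowBondWalk α n z Q) {f : UpperV → ℝ}
    (hf : (Function.support f).Finite) {t : ℝ} (ht : 0 < t) :
    HasDerivAt (pathMean Q f) (pathMean Q (walkGen α n f) t) t :=
  SolvesMartingaleProblem.hasDerivAt_pathMean hQ hf (UpperV.isObservable_of_finite_support hf)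
    (UpperV.isObservable_of_finite_support (UpperV.finite_support_walkGen α n hf))
    (hQ.continuous_pathMean (UpperV.finite_support_walkGen α n hf)) ht

theorem IsSlowBondWalk.pathMean_zero (hQ : IsSlowBondWalk α n z Q) (f : UpperV → ℝ) :
    pathMean Q f 0 = f z := by
  have h := integral_map (μ := Q) (CadlagPath.measurable_eval (E := UpperV) 0).aemeasurable
    (f := f) (measurable_of_countable f).aestronglyMeasurable
  rw [hQ.initial, integral_dirac] at h
  rw [pathMean, Real.toNNReal_zero, ← h]

open Classical in
/-- The indicator of a point of `V`. -/
noncomputable def UpperV.point (v u : UpperV) : ℝ := if u = v then 1 else 0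

theorem UpperV.finite_support_point (v : UpperV) : (Function.support (UpperV.point v)).Finite := by
  refine (Set.finite_singleton v).subset fun u hu => ?_
  by_contra h
  exact hu (if_neg h)

theorem UpperV.sum_mul_point (B : Finset UpperV) (k : UpperV → ℝ) (hk : ∀ v ∉ B, k v = 0)
    (u : UpperV) : ∑ v ∈ B, k v * UpperV.point v u = k u := by
  classical
  unfold UpperV.point
  simp only [mul_ite, mul_one, mul_zero]
  rw [Finset.sum_ite_eq]
  split_ifs with h
  · rfl
  · exact (hk u h).symm

theorem pairGen_sum {ι : Type*} (B : Finset ι) (k : ι → ℝ) (F : ι → ℤ → ℤ → ℝ) (x y : ℤ) :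
    pairGen α n (fun a b => ∑ v ∈ B, k v * F v a b) x y =
      ∑ v ∈ B, k v * pairGen α n (F v) x y := by
  unfold pairGen
  split_ifs
  · simp only [← Finset.sum_sub_distrib, Finset.mul_sum, ← Finset.sum_add_distrib, add_zero]
    exact Finset.sum_congr rfl fun _ _ => by ring
  · simp only [← Finset.sum_sub_distrib, Finset.mul_sum, ← Finset.sum_add_distrib]
    exact Finset.sum_congr rfl fun _ _ => by ring

theorem walkGen_sum (B : Finset UpperV) (k : UpperV → ℝ) (hk : ∀ v ∉ B, k v = 0) (u : UpperV) :
    ∑ v ∈ B, k v * walkGen α n (UpperV.point v) u = walkGen α n k u := by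
  simp_rw [walkGen_apply, ← pairGen_sum]
  congr 1
  funext a b
  unfold UpperV.extend
  split_ifs
  · exact UpperV.sum_mul_point B k hk _
  · simp

theorem pathMean_sum [IsProbabilityMeasure Q] (B : Finset UpperV) (k : UpperV → ℝ)
    (F : UpperV → UpperV → ℝ) (hF : ∀ v, (Function.support (F v)).Finite) (s : ℝ) :
    ∑ v ∈ B, k v * pathMean Q (F v) s = pathMean Q (fun u => ∑ v ∈ B, k v * F v u) s := by
  unfold pathMean
  rw [integral_finsetSum B fun v _ =>
    ((UpperV.isObservable_of_finite_support (hF v)).integrable _).const_mul _]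
  simp_rw [integral_const_mul]

/-- A cutoff with support in a ball of radius `N + 1` and slope `1 / (N + 1)`. -/
noncomputable def tentCutoff (N : ℕ) (a b : ℤ) : ℝ :=
  max 0 (1 - (|(a : ℝ)| + |(b : ℝ)|) / (N + 1))

theorem tentCutoff_mem_Icc (N : ℕ) (a b : ℤ) : tentCutoff N a b ∈ Set.Icc (0 : ℝ) 1 :=
  ⟨le_max_left _ _, max_le zero_le_one (by
    have : 0 ≤ (|(a : ℝ)| + |(b : ℝ)|) / (N + 1) := by positivity
    linarith)⟩

theorem abs_tentCutoff_sub_le (N : ℕ) (a b a' b' : ℤ)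
    (h : |(a' : ℝ) - a| + |(b' : ℝ) - b| ≤ 1) :
    |tentCutoff N a' b' - tentCutoff N a b| ≤ 1 / ((N : ℝ) + 1) := by
  have hN : (0 : ℝ) < N + 1 := by positivity
  unfold tentCutoff
  refine (abs_max_sub_max_le_max _ _ _ _).trans ?_
  rw [sub_self, abs_zero, max_eq_right (abs_nonneg _), sub_sub_sub_cancel_left, ← sub_div, abs_div,
    abs_of_pos hN]
  gcongr
  have h1 := abs_abs_sub_abs_le (a' : ℝ) a
  have h2 := abs_abs_sub_abs_le (b' : ℝ) b
  rw [abs_le] at h1 h2 ⊢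
  constructor <;> linarith [h1.1, h1.2, h2.1, h2.2]

theorem finite_support_tentCutoff (N : ℕ) :
    (Function.support fun v : UpperV => tentCutoff N v.1.1 v.1.2).Finite := by
  refine UpperV.finite_support_iff.2 ⟨N + 1, fun v hv => max_eq_left ?_⟩
  have h : ((N : ℝ) + 1) ≤ |(v.1.1 : ℝ)| + |(v.1.2 : ℝ)| := by exact_mod_cast hv
  have := (one_le_div (by positivity : (0 : ℝ) < N + 1)).2 h
  linarith

variable {φ g : ℝ → ℤ → ℤ → ℝ} {h : UpperV → ℝ} {T B M : ℝ}

/-- The function `F s = E[(χ φ_{T-s})(X_s)]` interpolates between `χ(z) φ_T(z)` and `E[(χ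
φ_0)(X_T)]`. In its derivative the generator terms cancel up to the commutator with the cutoff `χ`,
leaving `E[χ g]` and an error of order `1/(N+1)`. -/
theorem IsSlowBondWalk.tentCutoff_mul_le (hα : 0 ≤ α) (hQ : IsSlowBondWalk α n z Q) (hT : 0 ≤ T)
    (hφ : ∀ s a b, |φ s a b| ≤ B) (hφc : ∀ a b, Continuous fun s => φ s a b)
    (hgc : ∀ a b, Continuous fun s => g s a b)
    (hder : ∀ a b, a + 1 ≤ b → ∀ s, 0 < s →
      HasDerivAt (fun s => φ s a b) (pairGen α n (φ s) a b - g s a b) s)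
    (hh : IsObservable h) (hgh : ∀ s, 0 ≤ s → ∀ v : UpperV, |g s v.1.1 v.1.2| ≤ h v)
    (hM : ∀ v : UpperV, |φ 0 v.1.1 v.1.2| ≤ M) (N : ℕ) :
    tentCutoff N z.1.1 z.1.2 * |φ T z.1.1 z.1.2| ≤
      M + (∫ s in (0 : ℝ)..T, pathMean Q h s) +
        T * (4 * ((1 + α) * (1 / ((N : ℝ) + 1) * B))) := by
  have := hQ.isProbabilityMeasure
  set χ : UpperV → ℝ := fun v => tentCutoff N v.1.1 v.1.2 with hχ
  set δ : ℝ := 4 * ((1 + α) * (1 / ((N : ℝ) + 1) * B)) with hδ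
  set S : Finset UpperV := (finite_support_tentCutoff N).toFinset with hS
  have hSχ : ∀ v ∉ S, χ v = 0 := fun v hv => by
    by_contra hne
    exact hv ((Set.Finite.mem_toFinset _).2 hne)
  have hχ01 : ∀ v, 0 ≤ χ v ∧ χ v ≤ 1 := fun v => tentCutoff_mem_Icc N v.1.1 v.1.2
  -- Expanding over point masses separates the two dependences on `s`, so that the product rule
  -- applies to a finite sum and no time-dependent martingale problem is needed.
  set F : ℝ → ℝ := fun s => ∑ v ∈ S, (χ v * φ (T - s) v.1.1 v.1.2) *
    pathMean Q (UpperV.point v) s with hF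
  set F' : ℝ → ℝ := fun s => ∑ v ∈ S,
    ((χ v * -(pairGen α n (φ (T - s)) v.1.1 v.1.2 - g (T - s) v.1.1 v.1.2)) *
        pathMean Q (UpperV.point v) s +
      (χ v * φ (T - s) v.1.1 v.1.2) * pathMean Q (walkGen α n (UpperV.point v)) s) with hF'
  have hFeq : ∀ s, F s = pathMean Q (fun u => χ u * φ (T - s) u.1.1 u.1.2) s := by
    intro s
    rw [hF]
    simp only
    rw [pathMean_sum S _ _ UpperV.finite_support_point]
    congr 1
    funext u
    exact UpperV.sum_mul_point S (fun u => χ u * φ (T - s) u.1.1 u.1.2)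
      (fun v hv => by simp [hSχ v hv]) u
  have hF'eq : ∀ s, F' s = pathMean Q (fun u =>
      (χ u * -(pairGen α n (φ (T - s)) u.1.1 u.1.2 - g (T - s) u.1.1 u.1.2)) +
        walkGen α n (fun u => χ u * φ (T - s) u.1.1 u.1.2) u) s := by
    intro s
    have h1 := UpperV.isObservable_of_finite_support (f := fun u =>
      (χ u * -(pairGen α n (φ (T - s)) u.1.1 u.1.2 - g (T - s) u.1.1 u.1.2)))
      ((finite_support_tentCutoff N).subset (Function.support_mul_subset_left χ _))
    have h2 := UpperV.isObservable_of_finite_support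
      (f := walkGen α n (fun u => χ u * φ (T - s) u.1.1 u.1.2))
      (UpperV.finite_support_walkGen α n
        ((finite_support_tentCutoff N).subset (Function.support_mul_subset_left χ _)))
    rw [pathMean_add h1 h2, hF']
    simp only
    rw [Finset.sum_add_distrib, pathMean_sum S _ _ UpperV.finite_support_point,
      pathMean_sum S _ _ fun v => UpperV.finite_support_walkGen α n (UpperV.finite_support_point v)]
    congr 2
    · funext u
      exact UpperV.sum_mul_point S
        (fun u => χ u * -(pairGen α n (φ (T - s)) u.1.1 u.1.2 - g (T - s) u.1.1 u.1.2))
        (fun v hv => by simp [hSχ v hv]) u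
    · funext u
      exact walkGen_sum S (fun u => χ u * φ (T - s) u.1.1 u.1.2)
        (fun v hv => by simp [hSχ v hv]) u
  have hF'bound : ∀ s, s ≤ T → |F' s| ≤ pathMean Q h s + δ := by
    intro s hs
    rw [hF'eq, ← pathMean_const (P := Q) δ s, ← pathMean_add hh (isObservable_const δ)]
    refine abs_pathMean_le_pathMean (hh.add (isObservable_const δ)) (fun u => ?_) s
    have h1 : walkGen α n (fun u => χ u * φ (T - s) u.1.1 u.1.2) u =
        pairGen α n (fun a b => tentCutoff N a b * φ (T - s) a b) u.1.1 u.1.2 :=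
      walkGen_eq_pairGen α n (fun a b => tentCutoff N a b * φ (T - s) a b) u
    have h2 := abs_pairGen_mul_sub_le hα n (tentCutoff N) (φ (T - s)) (B := B)
      (δ := 1 / ((N : ℝ) + 1)) u.2 (fun a b _ => hφ _ a b)
      (fun a b => abs_tentCutoff_sub_le N a b (a + 1) b (by simp))
      (fun a b => abs_tentCutoff_sub_le N a b a (b + 1) (by simp))
    have h3 : |χ u * g (T - s) u.1.1 u.1.2| ≤ h u := by
      rw [abs_mul, abs_of_nonneg (hχ01 u).1]
      exact (mul_le_of_le_one_left (abs_nonneg _) (hχ01 u).2).trans (hgh _ (by linarith) u)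
    rw [h1]
    calc _ = |χ u * g (T - s) u.1.1 u.1.2 +
          (pairGen α n (fun a b => tentCutoff N a b * φ (T - s) a b) u.1.1 u.1.2 -
            tentCutoff N u.1.1 u.1.2 * pairGen α n (φ (T - s)) u.1.1 u.1.2)| := by
          congr 1; simp only [hχ]; ring
      _ ≤ _ := (abs_add_le _ _).trans (add_le_add h3 h2)
  have hsub : Continuous fun s : ℝ => T - s := by fun_prop
  have hFc : Continuous F := continuous_finsetSum _ fun v _ =>
    (continuous_const.mul ((hφc _ _).comp hsub)).mul
      (hQ.continuous_pathMean (UpperV.finite_support_point v))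
  have hF'c : Continuous F' := continuous_finsetSum _ fun v _ =>
    ((continuous_const.mul (((continuous_pairGen hφc α n _ _).comp hsub).sub
      ((hgc _ _).comp hsub)).neg).mul
        (hQ.continuous_pathMean (UpperV.finite_support_point v))).add
      ((continuous_const.mul ((hφc _ _).comp hsub)).mul (hQ.continuous_pathMean
        (UpperV.finite_support_walkGen α n (UpperV.finite_support_point v))))
  have hFd : ∀ s ∈ Set.Ioo 0 T, HasDerivAt F (F' s) s := by
    intro s hs
    refine HasDerivAt.fun_sum fun v _ => ?_
    have h1 := (hder v.1.1 v.1.2 v.2 (T - s) (by linarith [hs.2])).comp_const_sub T s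
    exact (h1.const_mul (χ v)).mul
      (hQ.hasDerivAt_pathMean (UpperV.finite_support_point v) hs.1)
  have hint := intervalIntegral.integral_eq_sub_of_hasDerivAt_of_le hT hFc.continuousOn hFd
    (hF'c.intervalIntegrable 0 T)
  have hI : IntervalIntegrable (pathMean Q h) volume 0 T := hh.intervalIntegrable 0 T
  have hbound : |∫ s in (0 : ℝ)..T, F' s| ≤ (∫ s in (0 : ℝ)..T, pathMean Q h s) + T * δ := by
    have h1 := intervalIntegral.norm_integral_le_of_norm_le hT
      (f := F') (g := fun s => pathMean Q h s + δ) (μ := volume)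
      (Eventually.of_forall fun s hs => hF'bound s hs.2)
      (hI.add intervalIntegrable_const)
    rwa [intervalIntegral.integral_add hI intervalIntegrable_const,
      intervalIntegral.integral_const, sub_zero, smul_eq_mul] at h1
  have hF0 : F 0 = tentCutoff N z.1.1 z.1.2 * φ T z.1.1 z.1.2 := by
    rw [hFeq, hQ.pathMean_zero, sub_zero]
  have hFT : |F T| ≤ M := by
    rw [hFeq]
    refine abs_pathMean_le (fun u => ?_) T
    rw [sub_self, abs_mul, abs_of_nonneg (hχ01 u).1]
    exact (mul_le_of_le_one_left (abs_nonneg _) (hχ01 u).2).trans (hM u)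
  have h4 : |F 0| ≤ |F T| + |F T - F 0| := by
    have := abs_sub_abs_le_abs_sub (F 0) (F T)
    rw [abs_sub_comm] at this
    linarith
  rw [hint] at hbound
  rw [hF0, abs_mul, abs_of_nonneg (tentCutoff_mem_Icc N z.1.1 z.1.2).1] at h4
  rw [hF0] at hbound
  linarith

/-- Duhamel's bound for bounded solutions of the backward equation of the walk with a source. -/
theorem IsSlowBondWalk.abs_le_add_integral (hα : 0 ≤ α) (hQ : IsSlowBondWalk α n z Q) (hT : 0 ≤ T)
    (hφ : ∀ s a b, |φ s a b| ≤ B) (hφc : ∀ a b, Continuous fun s => φ s a b)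
    (hgc : ∀ a b, Continuous fun s => g s a b)
    (hder : ∀ a b, a + 1 ≤ b → ∀ s, 0 < s →
      HasDerivAt (fun s => φ s a b) (pairGen α n (φ s) a b - g s a b) s)
    (hh : IsObservable h) (hgh : ∀ s, 0 ≤ s → ∀ v : UpperV, |g s v.1.1 v.1.2| ≤ h v)
    (hM : ∀ v : UpperV, |φ 0 v.1.1 v.1.2| ≤ M) :
    |φ T z.1.1 z.1.2| ≤ M + ∫ s in (0 : ℝ)..T, pathMean Q h s := by
  set r : ℝ := |(z.1.1 : ℝ)| + |(z.1.2 : ℝ)| with hr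
  set I : ℝ := ∫ s in (0 : ℝ)..T, pathMean Q h s with hI
  -- Since `χ(z) ≥ 1 - r/(N+1)`, removing the cutoff at `z` costs another `O(1/(N+1))`; then `N →
  -- ∞`.
  have key : ∀ N : ℕ, |φ T z.1.1 z.1.2| ≤
      M + I + (T * (4 * ((1 + α) * B)) + r * |φ T z.1.1 z.1.2|) * (1 / ((N : ℝ) + 1)) := by
    intro N
    have h1 := hQ.tentCutoff_mul_le hα hT hφ hφc hgc hder hh hgh hM N
    have h2 : 1 - r / (N + 1) ≤ tentCutoff N z.1.1 z.1.2 := le_max_right _ _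
    have h3 := mul_le_mul_of_nonneg_right h2 (abs_nonneg (φ T z.1.1 z.1.2))
    have h4 : (1 - r / ((N : ℝ) + 1)) * |φ T z.1.1 z.1.2| =
      |φ T z.1.1 z.1.2| - r * |φ T z.1.1 z.1.2| * (1 / ((N : ℝ) + 1)) := by ring
    rw [h4] at h3
    linarith
  have hlim : Tendsto (fun N : ℕ => M + I + (T * (4 * ((1 + α) * B)) + r * |φ T z.1.1 z.1.2|) *
      (1 / ((N : ℝ) + 1))) atTop (𝓝 (M + I + (T * (4 * ((1 + α) * B)) +
        r * |φ T z.1.1 z.1.2|) * 0)) :=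
    tendsto_const_nhds.add (tendsto_const_nhds.mul tendsto_one_div_add_atTop_nhds_zero_nat)
  rw [mul_zero, add_zero] at hlim
  exact ge_of_tendsto' hlim key

end Walk

/-! ### From the sink to local times. -/

section Correlations

theorem UpperV.isObservable_indicator (A : Set UpperV) :
    IsObservable (A.indicator fun _ => (1 : ℝ)) :=
  UpperV.isObservable ⟨1, fun v => by
    by_cases h : v ∈ A <;> simp [h]⟩

theorem integral_localTime {Q : Measure (CadlagPath UpperV)} [IsProbabilityMeasure Q]
    (A : Set UpperV) (t : ℝ) :
    ∫ ω, localTime A t ω ∂Q = ∫ s in (0 : ℝ)..t, pathMean Q (A.indicator fun _ => (1 : ℝ)) s :=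
  (UpperV.isObservable_indicator A).integral_integral_swap 0 t

theorem integral_localTime_nonneg {Q : Measure (CadlagPath UpperV)} (A : Set UpperV) {t : ℝ}
    (ht : 0 ≤ t) : 0 ≤ ∫ ω, localTime A t ω ∂Q :=
  integral_nonneg fun _ => intervalIntegral.integral_nonneg ht fun _ _ =>
    Set.indicator_nonneg (fun _ _ => zero_le_one) _

theorem abs_sub_le_of_near_lipschitz {ρ₀ : ℝ → ℝ} {K : ℝ≥0}
    (hleft : LipschitzOnWith K ρ₀ (Set.Iic 0)) (hright : LipschitzOnWith K ρ₀ (Set.Ioi 0))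
    {r : ℤ → ℝ} {c : ℝ} {n : ℕ} (hn : 1 ≤ n)
    (hr : ∀ x : ℤ, |r x - ρ₀ ((x : ℝ) / n)| ≤ c / n) {x : ℤ} (hx : x ≠ 0) :
    |r (x + 1) - r x| ≤ (2 * c + K) / n := by
  have hn0 : (0 : ℝ) < n := by exact_mod_cast hn
  have h1 := hr x
  have h2 := hr (x + 1)
  have h3 : |ρ₀ (((x + 1 : ℤ) : ℝ) / n) - ρ₀ ((x : ℝ) / n)| ≤ K / n := by
    have hd : dist (((x + 1 : ℤ) : ℝ) / n) ((x : ℝ) / n) = 1 / n := by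
      rw [Real.dist_eq, ← sub_div, abs_div, abs_of_pos hn0]
      simp
    have h4 : (K : ℝ) / n = K * dist (((x + 1 : ℤ) : ℝ) / n) ((x : ℝ) / n) := by
      rw [hd]; ring
    rw [h4, ← Real.dist_eq]
    -- For `x ≠ 0` the points `x/n` and `(x+1)/n` lie on the same side of the jump; for `x = -1`
    -- this uses that `0` belongs to the left half-line.
    rcases lt_or_gt_of_ne hx with h | h
    · refine hleft.dist_le_mul _ ?_ _ ?_
      · exact div_nonpos_of_nonpos_of_nonneg (by exact_mod_cast h) hn0.le
      · exact div_nonpos_of_nonpos_of_nonneg (by exact_mod_cast h.le) hn0.le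
    · refine hright.dist_le_mul _ ?_ _ ?_
      · exact div_pos (by exact_mod_cast (by omega : 0 < x + 1)) hn0
      · exact div_pos (by exact_mod_cast h) hn0
  have h5 : (2 * c + K) / (n : ℝ) = c / n + c / n + K / n := by ring
  rw [h5]
  rw [abs_le] at *
  constructor <;> linarith [h1.1, h1.2, h2.1, h2.2, h3.1, h3.2]

theorem IsSlowBondExclusion.abs_occCorr_le_localTime {α : ℝ} (hα : 0 ≤ α) {n : ℕ} (hn : 1 ≤ n)
    {μ : Measure Config} {P : Measure (CadlagPath Config)} (hP : IsSlowBondExclusion α n μ P)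
    {z : UpperV} {Q : Measure (CadlagPath UpperV)} (hQ : IsSlowBondWalk α n z Q) {M₀ M₁ : ℝ}
    (hα₁ : α / n ≤ M₁)
    (hmean : ∀ x : ℤ, x ≠ 0 → |siteMean μ (x + 1) - siteMean μ x| ≤ M₁)
    (hcorr : ∀ x y : ℤ, x + 1 ≤ y → |siteCorr μ x y| ≤ M₀) {t T : ℝ} (ht : 0 ≤ t) (htT : t ≤ T) :
    |occCorr P t z.1.1 z.1.2| ≤ M₀ +
      (M₁ ^ 2 * (∫ ω, localTime (upperDiag \ {cornerPt}) ((n : ℝ) ^ 2 * T) ω ∂Q) +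
        α / n * (∫ ω, localTime {cornerPt} ((n : ℝ) ^ 2 * T) ω ∂Q)) := by
  have := hP.isProbabilityMeasure
  have := hQ.isProbabilityMeasure
  have hn0 : (0 : ℝ) < (n : ℝ) ^ 2 := by
    have : (0 : ℝ) < n := by exact_mod_cast hn
    positivity
  have hαn : 0 ≤ α / n := by positivity
  set h₁ : UpperV → ℝ := (upperDiag \ {cornerPt}).indicator fun _ => (1 : ℝ) with hh₁
  set h₂ : UpperV → ℝ := ({cornerPt} : Set UpperV).indicator fun _ => (1 : ℝ) with hh₂
  have o₁ : IsObservable h₁ := UpperV.isObservable_indicator _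
  have o₂ : IsObservable h₂ := UpperV.isObservable_indicator _
  have hh := (o₁.const_mul (M₁ ^ 2)).add (o₂.const_mul (α / n))
  have p₁ : ∀ v, 0 ≤ h₁ v := Set.indicator_nonneg fun _ _ => zero_le_one
  have p₂ : ∀ v, 0 ≤ h₂ v := Set.indicator_nonneg fun _ _ => zero_le_one
  have hpos : ∀ v, 0 ≤ M₁ ^ 2 * h₁ v + α / n * h₂ v := fun v =>
    add_nonneg (mul_nonneg (sq_nonneg _) (p₁ v)) (mul_nonneg hαn (p₂ v))
  have hdiv : Continuous fun s : ℝ => s / (n : ℝ) ^ 2 := by fun_prop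
  -- The walk is not accelerated, so `φ` is run at time `s / n²`: the factor `n²` in its equation
  -- disappears and the horizon becomes `n² t`.
  have key := hQ.abs_le_add_integral hα (T := (n : ℝ) ^ 2 * t) (B := 2) (M := M₀)
    (φ := fun s a b => occCorr P (s / (n : ℝ) ^ 2) a b)
    (g := fun s a b => if b = a + 1 then bondRate α n a *
      (occMean P (s / (n : ℝ) ^ 2) (a + 1) - occMean P (s / (n : ℝ) ^ 2) a) ^ 2 else 0)
    (h := fun v => M₁ ^ 2 * h₁ v + α / n * h₂ v) (by positivity)
    (fun s a b => abs_occCorr_le _ a b) (fun a b => (hP.continuous_occCorr a b).comp hdiv)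
    (fun a b => by
      split_ifs
      · exact continuous_const.mul ((((hP.continuous_occMean (a + 1)).comp hdiv).sub
          ((hP.continuous_occMean a).comp hdiv)).pow 2)
      · exact continuous_const)
    (fun a b hab s hs => by
      have h1 := (hP.hasDerivAt_occCorr hab (div_pos hs hn0)).comp s
        ((hasDerivAt_id s).div_const ((n : ℝ) ^ 2))
      refine h1.congr_deriv ?_
      field_simp)
    hh
    (fun s hs v => by
      have hcur := hP.abs_current_le hα hα₁ hmean (div_nonneg hs hn0.le) v.1.1
      split_ifs with hd
      · rw [abs_of_nonneg (mul_nonneg (bondRate_nonneg hα n _) (sq_nonneg _))]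
        -- At the corner the squared density difference is at most `1` and the small rate `α/n`
        -- remains. Elsewhere the rate is `1` and the sink is the square of a current bounded by
        -- `M₁`.
        by_cases h0 : v.1.1 = 0
        · have hv : v = cornerPt := Subtype.ext (Prod.ext h0 (by rw [hd, h0]; rfl))
          have e2 : h₂ v = 1 := Set.indicator_of_mem (Set.mem_singleton_iff.2 hv) _
          have e1 := mul_nonneg (sq_nonneg M₁) (p₁ v)
          have m1 := occMean_mem_Icc (P := P) (s / (n : ℝ) ^ 2) (v.1.1 + 1)
          have m2 := occMean_mem_Icc (P := P) (s / (n : ℝ) ^ 2) v.1.1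
          have e3 : (occMean P (s / (n : ℝ) ^ 2) (v.1.1 + 1) -
              occMean P (s / (n : ℝ) ^ 2) v.1.1) ^ 2 ≤ 1 := by
            rw [sq_le_one_iff_abs_le_one, abs_le]
            constructor <;> linarith [m1.1, m1.2, m2.1, m2.2]
          rw [bondRate, if_pos h0, e2, mul_one]
          exact (mul_le_of_le_one_right hαn e3).trans (le_add_of_nonneg_left e1)
        · have hv : v ∈ upperDiag \ {cornerPt} := ⟨hd, fun h => h0 (by rw [h]; rfl)⟩
          have e1 : h₁ v = 1 := Set.indicator_of_mem hv _
          have e2 := mul_nonneg hαn (p₂ v)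
          rw [bondRate, if_neg h0, one_mul] at hcur
          rw [bondRate, if_neg h0, e1, mul_one, one_mul, ← sq_abs]
          exact (pow_le_pow_left₀ (abs_nonneg _) hcur 2).trans (le_add_of_nonneg_right e2)
      · rw [abs_zero]
        exact hpos v)
    (fun v => by
      have hμ : lawAt P 0 = μ := hP.initial
      have h1 := siteCorr_lawAt (P := P) v.1.1 v.1.2 0
      rw [hμ, NNReal.coe_zero] at h1
      rw [zero_div, ← h1]
      exact hcorr _ _ v.2)
  rw [mul_div_cancel_left₀ t hn0.ne'] at key
  refine key.trans (add_le_add le_rfl ?_)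
  rw [integral_localTime, integral_localTime, ← intervalIntegral.integral_const_mul,
    ← intervalIntegral.integral_const_mul, ← intervalIntegral.integral_add
      ((o₁.intervalIntegrable _ _).const_mul _) ((o₂.intervalIntegrable _ _).const_mul _)]
  have hpm : ∀ s, pathMean Q (fun v => M₁ ^ 2 * h₁ v + α / n * h₂ v) s =
      M₁ ^ 2 * pathMean Q h₁ s + α / n * pathMean Q h₂ s := fun s => by
    rw [pathMean_add (o₁.const_mul _) (o₂.const_mul _), pathMean_const_mul, pathMean_const_mul]
  simp_rw [← hpm]
  -- The integrand is nonnegative, so the horizon may be enlarged from `n² t` to `n² T`, which gives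
  -- uniformity in `t`.
  exact intervalIntegral.integral_mono_interval le_rfl (by positivity)
    (mul_le_mul_of_nonneg_left htT hn0.le)
    (Eventually.of_forall fun s => integral_nonneg fun ω => hpos _) (hh.intervalIntegrable _ _)

end Correlations

theorem proposition4p1 (α T : ℝ) (hα : 0 < α) (hT : 0 < T)
    (ρ₀ : ℝ → ℝ) (hρ₀ : ∀ u, ρ₀ u ∈ Set.Icc (0 : ℝ) 1)
    (K : ℝ≥0) (hleft : LipschitzOnWith K ρ₀ (Set.Iic 0))
    (hright : LipschitzOnWith K ρ₀ (Set.Ioi 0))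
    (μ : ℕ → Measure Config) (hμ : ∀ n, IsProbabilityMeasure (μ n))
    (c₁ : ℝ) (hmean : ∀ n : ℕ, 1 ≤ n → ∀ x : ℤ,
      |siteMean (μ n) x - ρ₀ ((x : ℝ) / (n : ℝ))| ≤ c₁ / (n : ℝ))
    (c₂ : ℝ) (hcorr : ∀ n : ℕ, 1 ≤ n → ∀ x y : ℤ, x + 1 ≤ y →
      |siteCorr (μ n) x y| ≤ c₂ / (n : ℝ)) :
    ∃ C : ℝ, 0 < C ∧ ∀ n : ℕ, 1 ≤ n →
      ∀ P : Measure (CadlagPath Config), IsSlowBondExclusion α n (μ n) P →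
      ∀ (z : UpperV) (Q : Measure (CadlagPath UpperV)), IsSlowBondWalk α n z Q →
      ∀ t : ℝ≥0, (t : ℝ) ≤ T →
        |siteCorr (lawAt P t) z.1.1 z.1.2| ≤
          C / (n : ℝ) +
          C * (1 / (n : ℝ) ^ 2 *
                (∫ ω, localTime (upperDiag \ {cornerPt}) ((n : ℝ) ^ 2 * T) ω ∂Q) +
               1 / (n : ℝ) *
                (∫ ω, localTime {cornerPt} ((n : ℝ) ^ 2 * T) ω ∂Q)) := by

  -- The three summands dominate the initial correlations, the squared current bound on `D \
  -- {(0,1)}` and the rate at `(0,1)`. The `α` inside the square ensures that the current bound also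
  -- dominates the boundary value `α/n`.
  refine ⟨|c₂| + (2 * |c₁| + K + α) ^ 2 + α, by positivity, fun n hn P hP z Q hQ t ht => ?_⟩
  have hn0 : (0 : ℝ) < n := by exact_mod_cast hn
  have hT0 : 0 ≤ (n : ℝ) ^ 2 * T := by positivity
  have hmean' : ∀ x : ℤ, x ≠ 0 →
      |siteMean (μ n) (x + 1) - siteMean (μ n) x| ≤ (2 * |c₁| + K + α) / n := fun x hx =>
    (abs_sub_le_of_near_lipschitz hleft hright hn (hmean n hn) hx).trans
      (div_le_div_of_nonneg_right (by linarith [le_abs_self c₁]) hn0.le)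
  have hα₁ : α / n ≤ (2 * |c₁| + K + α) / n :=
    div_le_div_of_nonneg_right (by linarith [abs_nonneg c₁, K.coe_nonneg]) hn0.le
  have h := hP.abs_occCorr_le_localTime hα.le hn hQ hα₁ hmean' (hcorr n hn) t.coe_nonneg ht
  have hL₁ := integral_localTime_nonneg (Q := Q) (upperDiag \ {cornerPt}) hT0
  have hL₂ := integral_localTime_nonneg (Q := Q) {cornerPt} hT0
  rw [siteCorr_lawAt]
  refine h.trans ?_
  set L₁ := ∫ ω, localTime (upperDiag \ {cornerPt}) ((n : ℝ) ^ 2 * T) ω ∂Q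
  set L₂ := ∫ ω, localTime {cornerPt} ((n : ℝ) ^ 2 * T) ω ∂Q
  have e₁ : ((2 * |c₁| + K + α) / n) ^ 2 * L₁ =
      (2 * |c₁| + K + α) ^ 2 * (1 / (n : ℝ) ^ 2 * L₁) := by ring
  have e₂ : α / n * L₂ = α * (1 / (n : ℝ) * L₂) := by ring
  have hsq := sq_nonneg (2 * |c₁| + K + α)
  rw [e₁, e₂, mul_add]
  have l₁ : 0 ≤ 1 / (n : ℝ) ^ 2 * L₁ := by positivity
  have l₂ : 0 ≤ 1 / (n : ℝ) * L₂ := by positivity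
  refine add_le_add ?_ (add_le_add ?_ ?_)
  · exact div_le_div_of_nonneg_right (by linarith [le_abs_self c₂]) hn0.le
  · exact mul_le_mul_of_nonneg_right (by linarith [abs_nonneg c₂]) l₁
  · exact mul_le_mul_of_nonneg_right (by linarith [abs_nonneg c₂]) l₂
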